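/- **Multivariate hook length formula for $d$-complete posets.** *The posets $d_k(1)$.* For $k\ge 3$ let $d_k(1)$ be the poset with $2k-2$ elements consisting of two incomparable *side elements*, a chain of $k-2$ *neck elements* lying above both side elements, and a chain of $k-2$ *tail elements* lying below both side elements. Let $P$ be a finite poset. An interval $[p,q]$ of $P$ isomorphic to $d_k(1)$ for some $k\ge3$ is called a $d_k$-interval, or simply a $d$-interval; its side, neck and tail elements are those corresponding to the side, neck and tail elements of $d_k(1)$. A convex subset of $P$ isomorphic to $d_k(1)$ with its greatest element removed is called $d_k^-$-convex, or simply $d^-$-convex. The finite poset $P$ is *$d$-complete* if 1. for each $k\ge 3$ and each $d_k^-$-convex subset $I$ of $P$ there is $z\in P$ such that $I\cup\{z\}$ is a $d_k$-interval; 2. for each $d$-interval $[w,z]$, the element $z$ covers no element outside $[w,z]$; 3. no two distinct $d^-$-convex sets differ only in their minimal elements. *Diagonals.* The diagonals of $P$ are the classes of the equivalence relation on $P$ generated by $p\sim q$ whenever $[p,q]$ is a $d$-interval. Write $\mathcal D(P)$ for the set of diagonals and $D(p)$ for the diagonal containing $p$. *Hook vectors.* The hook vectors $\mathbf h_P(p)=[h_P^{(D)}(p)]_{D\in\mathcal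 D(P)}\in\mathbb Z^{\mathcal D(P)}$ are defined recursively. If $p$ is not a neck element of any $d$-interval, then $h_P^{(D)}(p)$ is the number of $q\in D$ with $q\le p$. If $p$ is the maximum of some $d$-interval $[p',p]$ with side elements $w,z$, then $\mathbf h_P(p)=\mathbf h_P(w)+\mathbf h_P(z)-\mathbf h_P(p')$. *Hook polynomials and weights.* Let $\{x_D\}_{D\in\mathcal D(P)}$ be indeterminates and put $H_p(\mathbf x)=\sum_{D\in\mathcal D(P)}h_P^{(D)}(p)\,x_D$ for $p\in P$. A linear extension $T$ of $P$ is written as a listing $p_1>p_2>\dots>p_n$ of all elements of $P$, $n=|P|$, in which larger elements of $P$ come earlier; its weight is the rational function $\mathrm{weight}(T)\in\mathbb Q(x_D : D\in\mathcal D(P))$ given by $$\mathrm{weight}(T)^{-1}=\prod_{i=1}^n\ \sum_{j=i}^n x_{D(p_j)} .$$ **Theorem.** Let $P$ be a $d$-complete poset. Then the hook vectors of $P$ are well defined (the recursive rule gives the same vector for every admissible choice of $d$-interval), and $$\sum_T \mathrm{weight}(T)=\frac{1}{\prod_{p\in P}H_p(\mathbf x)}\qquad\text{in } \mathbb Q(x_D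 : D\in\mathcal D(P)),$$ where the sum is over all linear extensions $T$ of $P$. -/

import Mathlib

namespace DComplete

/-! ### The double-tailed diamonds `d_k(1)` -/

/-- The underlying set of the poset `d_k(1)` (for `k ≥ 3`): `k - 2` tail elements, two side
elements and `k - 2` neck elements.  Within the tail and within the neck, larger indices are
higher up. -/
inductive DPoset (k : ℕ) : Type
  | tail (i : Fin (k - 2))
  | side (b : Bool)
  | neck (i : Fin (k - 2))

namespace DPoset

/-- The height of an element of `d_k(1)`. The two side elements have the same height, and these
are the only two distinct elements with the same height. -/
def height {k : ℕ} : DPoset k → ℕ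
  | tail i => i
  | side _ => k - 2
  | neck i => k - 1 + i

/-- The order of `d_k(1)`: all pairs of distinct elements are ordered by height, except that the
two side elements are incomparable. -/
instance (k : ℕ) : PartialOrder (DPoset k) where
  le x y := x = y ∨ x.height < y.height
  le_refl x := Or.inl rfl
  le_trans x y z := by
    rintro (rfl | hxy) (rfl | hyz)
    · exact Or.inl rfl
    · exact Or.inr hyz
    · exact Or.inr hxy
    · exact Or.inr (hxy.trans hyz)
  le_antisymm x y := by
    rintro (rfl | hxy) (h | hyx)
    · rfl
    · rfl
    · exact h.symm
    · exact absurd hxy hyx.asymm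

end DPoset

section Poset

variable {P : Type*} [PartialOrder P]

/-- The interval `[p, q]` of `P` is a `d_k`-interval: it is isomorphic to `d_k(1)`, `k ≥ 3`. -/
def IsDkInterval (k : ℕ) (p q : P) : Prop :=
  3 ≤ k ∧ Nonempty (Set.Icc p q ≃o DPoset k)

/-- The interval `[p, q]` of `P` is a `d`-interval. -/
def IsDInterval (p q : P) : Prop :=
  ∃ k : ℕ, IsDkInterval k p q

/-- The subset `I` of `P` is `d_k^-`-convex: it is convex and isomorphic to `d_k(1)` with its
greatest element removed, `k ≥ 3`. -/
def IsDkMinusConvex (k : ℕ) (I : Set P) : Prop :=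
  3 ≤ k ∧ I.OrdConnected ∧ Nonempty (I ≃o {x : DPoset k // ¬ IsTop x})

variable (P) in
/-- The three axioms of a `d`-complete poset (finiteness is a separate hypothesis). -/
structure IsDComplete : Prop where
  /-- Every `d_k^-`-convex subset can be completed to a `d_k`-interval by one more element. -/
  exists_completion : ∀ (k : ℕ) (I : Set P), IsDkMinusConvex k I →
    ∃ z a b : P, insert z I = Set.Icc a b ∧ IsDkInterval k a b
  /-- The top of a `d`-interval covers no element outside that interval. -/
  mem_of_covBy : ∀ w z : P, IsDInterval w z → ∀ y : P, y ⋖ z → y ∈ Set.Icc w z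
  /-- No two distinct `d^-`-convex sets differ only in their minimal elements. -/
  eq_of_sdiff_eq : ∀ (k l : ℕ) (I J : Set P), IsDkMinusConvex k I → IsDkMinusConvex l J →
    ∀ a b : P, IsLeast I a → IsLeast J b → I \ {a} = J \ {b} → I = J

/-- `p` is a neck element of some `d`-interval of `P`. -/
def IsNeck (p : P) : Prop :=
  ∃ (k : ℕ) (a b : P) (e : Set.Icc a b ≃o DPoset k) (i : Fin (k - 2)),
    3 ≤ k ∧ ((e.symm (DPoset.neck i) : Set.Icc a b) : P) = p

/-- `[p', p]` is a `d`-interval whose two side elements are `w` and `z`. -/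
def IsDIntervalWithSides (p' w z p : P) : Prop :=
  ∃ (k : ℕ) (e : Set.Icc p' p ≃o DPoset k), 3 ≤ k ∧
    ((e.symm (DPoset.side false) : Set.Icc p' p) : P) = w ∧
    ((e.symm (DPoset.side true) : Set.Icc p' p) : P) = z

theorem IsDIntervalWithSides.lt_top {p' w z p : P} (h : IsDIntervalWithSides p' w z p) :
    p' < p ∧ w < p ∧ z < p := by
  obtain ⟨k, e, -, rfl, rfl⟩ := h
  have key : ∀ b : Bool, ((e.symm (DPoset.side b) : Set.Icc p' p) : P) < p := by
    intro b
    refine lt_of_le_of_ne (e.symm (DPoset.side b)).2.2 fun heq => ?_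
    have hle : e.symm (DPoset.side (!b)) ≤ e.symm (DPoset.side b) := by
      rw [← Subtype.coe_le_coe, heq]
      exact (e.symm (DPoset.side (!b))).2.2
    rcases e.symm.le_iff_le.1 hle with h | h
    · cases b <;> simp at h
    · exact lt_irrefl _ h
  exact ⟨(e.symm (DPoset.side false)).2.1.trans_lt (key false), key false, key true⟩

/-! ### Diagonals -/

variable (P) in
/-- The set of diagonals of `P`: the classes of the equivalence relation generated by
`p ∼ q` whenever `[p, q]` is a `d`-interval. -/
def Diagonal : Type _ :=
  Quotient (Relation.EqvGen.setoid (IsDInterval (P := P)))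

/-- The diagonal `D(p)` containing `p`. -/
def diag (p : P) : Diagonal P :=
  Quotient.mk _ p

instance [Finite P] : Finite (Diagonal P) :=
  inferInstanceAs (Finite (Quotient _))

noncomputable instance [Finite P] : Fintype (Diagonal P) :=
  Fintype.ofFinite _

/-! ### Hook vectors -/

/-- The recursive rules that define the hook vectors: a family `h : P → (Diagonal P → ℤ)` obeys
them if `h p D` counts the elements of `D` below `p` (nonstrictly) when `p` is not a neck element of
any `d`-interval, and `h p = h w + h z - h p'` for *every* `d`-interval `[p', p]` with side
elements `w` and `z`. -/
structure IsHookVectorFamily (h : P → Diagonal P → ℤ) : Prop where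
  of_not_neck : ∀ p : P, ¬ IsNeck p →
    ∀ D : Diagonal P, h p D = (Nat.card {q : P // q ≤ p ∧ diag q = D} : ℤ)
  of_dInterval : ∀ p' w z p : P, IsDIntervalWithSides p' w z p → h p = h w + h z - h p'

open Classical in
/-- The hook vectors `h_P(p) = [h_P^{(D)}(p)]_D`, computed by recursion on `p`.  In a `d`-complete
poset they satisfy `IsHookVectorFamily`; in an arbitrary finite poset the value could depend on
the choice of the `d`-interval with top `p`. -/
noncomputable def hookVector [Finite P] (p : P) : Diagonal P → ℤ :=
  if h : ∃ t : P × P × P, IsDIntervalWithSides t.1 t.2.1 t.2.2 p then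
    hookVector h.choose.2.1 + hookVector h.choose.2.2 - hookVector h.choose.1
  else
    fun D => (Nat.card {q : P // q ≤ p ∧ diag q = D} : ℤ)
termination_by (wellFounded_lt (α := P)).wrap p
decreasing_by
  · exact h.choose_spec.lt_top.2.1
  · exact h.choose_spec.lt_top.2.2
  · exact h.choose_spec.lt_top.1

/-- The hook polynomial `H_p(x) = ∑_D h_P^{(D)}(p) x_D`. -/
noncomputable def hookPoly [Finite P] (p : P) : MvPolynomial (Diagonal P) ℚ :=
  ∑ D : Diagonal P, hookVector p D • MvPolynomial.X D

/-! ### Linear extensions and their weights -/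

variable (P) in
/-- The linear extensions of `P`, as enumerations `p_1 > p_2 > ⋯ > p_n` of the elements of `P`
(each element exactly once) in which every element comes before all elements that are smaller
in `P`. -/
def LinExt [Fintype P] : Type _ :=
  {T : Fin (Fintype.card P) ≃ P // ∀ i j, T j < T i → i < j}

instance [Fintype P] : Finite (LinExt P) :=
  inferInstanceAs (Finite {_T : Fin (Fintype.card P) ≃ P // _})

noncomputable instance [Fintype P] : Fintype (LinExt P) :=
  Fintype.ofFinite _

variable (P) in
/-- The field `ℚ(x_D : D a diagonal of P)` of rational functions. -/
abbrev RatField : Type _ :=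
  FractionRing (MvPolynomial (Diagonal P) ℚ)

/-- The weight of a linear extension `T`, given by `p_1 > ⋯ > p_n`: the rational function with
`weight(T)⁻¹ = ∏_{i=1}^n ∑_{j=i}^n x_{D(p_j)}`. -/
noncomputable def weight [Fintype P] (T : LinExt P) : RatField P :=
  (∏ i : Fin (Fintype.card P), ∑ j ∈ Finset.Ici i,
    algebraMap (MvPolynomial (Diagonal P) ℚ) (RatField P)
      (MvPolynomial.X (diag (T.1 j))))⁻¹

end Poset

end DComplete

namespace DComplete

/-! ### A recursive description of `d`-intervals -/

namespace DPoset

/-! Splitting off the first entry of a linear extension gives a recursion for the sum of weights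
over the complement of an upper set `F`. Hence the formula follows from polynomials `ξ F`, indexed
by upper sets, with `ξ ∅ = 1`, with `ξ univ` the product of the hook polynomials, and with the Pieri
rule: (sum of the variables outside `F`) times `ξ F` is the sum of `ξ (insert q F)` over the
elements `q` addable to `F`. Dividing by the linear factors one at a time then gives the theorem
(`listingSum_mul`).

The `ξ F` imitate localised equivariant Schubert classes of a minuscule Weyl group element.
Diagonals are the nodes of a Dynkin diagram, adjacent when a cover joins them, and the variables are
the simple roots. The poset is built from the top down. Adding a minimal element `p` to `U` applies
the simple reflection `s` of its colour: the new value at `F` is `s (ξ F)`, read as `0` if `p ∈ F`,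
plus `X (col p)` times the same values at `F` with a removable element of this colour deleted. The
Pieri rule survives (`pieri_step`) because the weight of `F` pairs with the coroot to `-1`, `1` or
`0` according as the colour has a removable element, an addable element or neither (`wt_of_minimal`,
`wt_of_addable`, `wt_eq_zero`).

The value at the full set becomes `X (col p)` times the reflected old value, so it is a product of
roots. These roots are the hook polynomials (`isHook_insert`). The delicate case is an element that
is no neck, where the root must be the sum of the colours below it; this rests on `sum_mult_le` and
on the interval estimate `card_adj_le_one_of_Icc`.

All this uses only the properties in `Coloring`. The axioms of a `d`-complete poset serve to prove
them. The top of a `d`-interval determines its bottom and sides (`dInt_unique_of_top`), which also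
makes hook vectors well defined; the bottom determines the top (`dInt_unique_of_bot`), so diagonals
are chains. Finally `isHeap` controls the elements of adjacent colours: only the two given by `Nb`
between consecutive elements of a diagonal, and at most one above the top of a diagonal. -/

theorem le_iff {k : ℕ} {x y : DPoset k} : x ≤ y ↔ x = y ∨ x.height < y.height := Iff.rfl

/-- The embedding of `d_k(1)` into `d_{k+1}(1)` that misses the bottom and the top. -/
def shift {m : ℕ} : DPoset (m + 3) → DPoset (m + 4)
  | tail i => tail (Fin.succ (n := m + 1) i)
  | side b => side b
  | neck i => neck (Fin.castSucc (n := m + 1) i)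

/-- The bottom of `d_{m+3}(1)`. -/
def bot' (m : ℕ) : DPoset (m + 3) := tail (0 : Fin (m + 1))

/-- The top of `d_{m+3}(1)`. -/
def top' (m : ℕ) : DPoset (m + 3) := neck (Fin.last m)

theorem height_shift {m : ℕ} (x : DPoset (m + 3)) : (shift x).height = x.height + 1 := by
  cases x with
  | tail i => simp [shift, height]
  | side b => simp [shift, height]
  | neck i => simp [shift, height]; omega

theorem shift_injective {m : ℕ} : Function.Injective (shift (m := m)) := by
  intro x y h
  cases x <;> cases y <;> simp_all [shift]

theorem shift_le_shift {m : ℕ} {x y : DPoset (m + 3)} : shift x ≤ shift y ↔ x ≤ y := by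
  rw [le_iff, le_iff, height_shift, height_shift, shift_injective.eq_iff, Nat.add_lt_add_iff_right]

theorem height_le {m : ℕ} (x : DPoset (m + 3)) : x.height ≤ 2 * m + 2 := by
  cases x with
  | tail i => have := i.2; simp [height]; omega
  | side b => simp [height]; omega
  | neck i => have := i.2; simp [height]; omega

theorem bot'_le {m : ℕ} (x : DPoset (m + 3)) : bot' m ≤ x := by
  rw [le_iff]
  cases x with
  | tail i =>
    rcases Fin.eq_zero_or_eq_succ (n := m) i with h | ⟨j, h⟩
    · left; rw [h]; rfl
    · right; rw [h]; simp [bot', height]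
  | side b => right; simp [bot', height]
  | neck i => right; simp [bot', height]

theorem le_top' {m : ℕ} (x : DPoset (m + 3)) : x ≤ top' m := by
  rw [le_iff]
  cases x with
  | tail i => right; have := i.2; simp [top', height]; omega
  | side b => right; simp [top', height]; omega
  | neck i =>
    rcases eq_or_ne i (Fin.last m) with h | h
    · left; rw [h]; rfl
    · right
      have h1 : (i : ℕ) < m + 1 := i.2
      have h2 : (i : ℕ) ≠ m := fun h' => h (Fin.ext h')
      simp [top', height]; omega

theorem isTop_iff {m : ℕ} {x : DPoset (m + 3)} : IsTop x ↔ x = top' m :=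
  ⟨fun h => le_antisymm (le_top' x) (h _), fun h => h ▸ le_top'⟩

theorem eq_bot_or_top_or_shift {m : ℕ} (x : DPoset (m + 4)) :
    x = bot' (m + 1) ∨ x = top' (m + 1) ∨ ∃ y, x = shift y := by
  cases x with
  | tail i =>
    rcases Fin.eq_zero_or_eq_succ (n := m + 1) i with h | ⟨j, h⟩
    · left; rw [h]; rfl
    · right; right; exact ⟨tail j, by rw [h]; rfl⟩
  | side b => right; right; exact ⟨side b, rfl⟩
  | neck i =>
    rcases Fin.eq_castSucc_or_eq_last (n := m + 1) i with ⟨j, h⟩ | h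
    · right; right; exact ⟨neck j, by rw [h]; rfl⟩
    · right; left; rw [h]; rfl

theorem shift_ne_bot' {m : ℕ} (x : DPoset (m + 3)) : shift x ≠ bot' (m + 1) := by
  intro h
  have := congrArg height h
  rw [height_shift] at this
  simp [bot', height] at this

theorem shift_ne_top' {m : ℕ} (x : DPoset (m + 3)) : shift x ≠ top' (m + 1) := by
  intro h
  have := congrArg height h
  rw [height_shift] at this
  have h2 := height_le x
  have h3 : (top' (m + 1)).height = m + 1 + 3 - 1 + (m + 1) := rfl
  omega

theorem bot'_ne_top' {m : ℕ} : bot' m ≠ top' m := by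
  simp [bot', top']

theorem eq_three (x : DPoset 3) :
    x = bot' 0 ∨ x = top' 0 ∨ x = side false ∨ x = side true := by
  cases x with
  | tail i => left; exact congrArg tail (Subsingleton.elim (α := Fin 1) _ _)
  | side b => cases b <;> simp
  | neck i => right; left; exact congrArg neck (Subsingleton.elim (α := Fin 1) _ _)

end DPoset

open DPoset Set

section

variable {P : Type*} [PartialOrder P]

/-- `DInt p z a b`: the interval `[p, z]` is a `d`-interval with sides `a` and `b`, built from
the bottom and top of the innermost diamond outwards. -/
inductive DInt : P → P → P → P → Prop
  | diamond {p a b z : P} : p ⋖ a → p ⋖ b → a ⋖ z → b ⋖ z → a ≠ b →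
      (∀ x, p ≤ x → x ≤ z → x = p ∨ x = a ∨ x = b ∨ x = z) → DInt p z a b
  | extend {t n a b p z : P} : DInt t n a b → p ⋖ t → n ⋖ z →
      (∀ x, p ≤ x → x ≤ z → x = p ∨ x = z ∨ (t ≤ x ∧ x ≤ n)) → DInt p z a b

theorem DInt.sides {p z a b : P} (h : DInt p z a b) : p < a ∧ a < z ∧ p < b ∧ b < z ∧ a ≠ b := by
  induction h with
  | diamond h1 h2 h3 h4 h5 _ => exact ⟨h1.lt, h3.lt, h2.lt, h4.lt, h5⟩
  | extend _ h1 h2 _ ih =>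
    exact ⟨h1.lt.trans ih.1, ih.2.1.trans h2.lt, h1.lt.trans ih.2.2.1, ih.2.2.2.1.trans h2.lt,
      ih.2.2.2.2⟩

theorem DInt.lt {p z a b : P} (h : DInt p z a b) : p < z := h.sides.1.trans h.sides.2.1

theorem DInt.symm {p z a b : P} (h : DInt p z a b) : DInt p z b a := by
  induction h with
  | diamond h1 h2 h3 h4 h5 h6 =>
    exact .diamond h2 h1 h4 h3 h5.symm fun x hx hz => by have := h6 x hx hz; tauto
  | extend _ h1 h2 h3 ih => exact .extend ih h1 h2 h3

theorem emb_bot {m : ℕ} {f : DPoset (m + 3) ↪o P} {p z : P} (hf : range f = Icc p z) :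
    f (bot' m) = p ∧ f (top' m) = z := by
  have h0 : f (bot' m) ∈ Icc p z := hf ▸ mem_range_self _
  have hpz : p ≤ z := h0.1.trans h0.2
  obtain ⟨x, hx⟩ : p ∈ range f := hf ▸ ⟨le_rfl, hpz⟩
  obtain ⟨y, hy⟩ : z ∈ range f := hf ▸ ⟨hpz, le_rfl⟩
  have h1 : f (top' m) ∈ Icc p z := hf ▸ mem_range_self _
  exact ⟨le_antisymm (hx ▸ f.le_iff_le.2 (bot'_le x)) h0.1,
    le_antisymm h1.2 (hy ▸ f.le_iff_le.2 (le_top' y))⟩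

theorem side_not_le {k : ℕ} {b c : Bool} (h : b ≠ c) : ¬ (side b : DPoset k) ≤ side c := by
  rw [DPoset.le_iff]; simp [DPoset.height, h]

/-- The restriction of an embedding of `d_{k+1}(1)` to the copy of `d_k(1)` inside it. -/
def shiftEmb {m : ℕ} (f : DPoset (m + 4) ↪o P) : DPoset (m + 3) ↪o P :=
  OrderEmbedding.ofMapLEIff (fun x => f (shift x)) fun x y => by
    rw [f.le_iff_le, shift_le_shift]

theorem bot_lt_shiftEmb {m : ℕ} (f : DPoset (m + 4) ↪o P) (x : DPoset (m + 3)) :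
    f (bot' (m + 1)) < shiftEmb f x :=
  lt_of_le_of_ne (f.le_iff_le.2 (bot'_le _)) fun h => shift_ne_bot' x (f.injective h.symm)

theorem shiftEmb_lt_top {m : ℕ} (f : DPoset (m + 4) ↪o P) (x : DPoset (m + 3)) :
    shiftEmb f x < f (top' (m + 1)) :=
  lt_of_le_of_ne (f.le_iff_le.2 (le_top' _)) fun h => shift_ne_top' x (f.injective h)

theorem range_shiftEmb {m : ℕ} {f : DPoset (m + 4) ↪o P} {p z : P} (hf : range f = Icc p z) :
    range (shiftEmb f) = Icc (shiftEmb f (bot' m)) (shiftEmb f (top' m)) := by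
  obtain ⟨rfl, rfl⟩ := emb_bot (m := m + 1) hf
  ext y
  constructor
  · rintro ⟨x, rfl⟩
    exact ⟨(shiftEmb f).le_iff_le.2 (bot'_le x), (shiftEmb f).le_iff_le.2 (le_top' x)⟩
  · rintro ⟨h1, h2⟩
    obtain ⟨x, rfl⟩ : y ∈ range f :=
      hf ▸ ⟨(bot_lt_shiftEmb f _).le.trans h1, h2.trans (shiftEmb_lt_top f _).le⟩
    rcases eq_bot_or_top_or_shift x with rfl | rfl | ⟨x, rfl⟩
    · exact absurd h1 (bot_lt_shiftEmb f _).not_ge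
    · exact absurd h2 (shiftEmb_lt_top f _).not_ge
    · exact ⟨x, rfl⟩

/-- Deleting bottom and top of a double-tailed diamond leaves the next smaller one, with the same
sides; this is the induction. -/
theorem dInt_of_emb (m : ℕ) : ∀ (f : DPoset (m + 3) ↪o P) (p z : P), range f = Icc p z →
    DInt p z (f (side false)) (f (side true)) := by
  induction m with
  | zero =>
    intro f p z hf
    obtain ⟨rfl, rfl⟩ := emb_bot hf
    have key : ∀ x, f (bot' 0) ≤ x → x ≤ f (top' 0) →
        x = f (bot' 0) ∨ x = f (side false) ∨ x = f (side true) ∨ x = f (top' 0) := by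
      intro x h1 h2
      obtain ⟨y, rfl⟩ : x ∈ range f := hf ▸ ⟨h1, h2⟩
      rcases eq_three y with h | h | h | h <;> simp [h]
    have hb : ∀ b : Bool, f (bot' 0) < f (side b) := fun b =>
      lt_of_le_of_ne (f.le_iff_le.2 (bot'_le _)) (by simp [f.injective.eq_iff, bot'])
    have ht : ∀ b : Bool, f (side b) < f (top' 0) := fun b =>
      lt_of_le_of_ne (f.le_iff_le.2 (le_top' _)) (by simp [f.injective.eq_iff, top'])
    have hs : ∀ b c : Bool, f (side b) < f (side c) → False := by
      intro b c h
      have hbc : b ≠ c := by rintro rfl; exact lt_irrefl _ h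
      exact side_not_le hbc (f.le_iff_le.1 h.le)
    refine .diamond ⟨hb _, ?_⟩ ⟨hb _, ?_⟩ ⟨ht _, ?_⟩ ⟨ht _, ?_⟩ (by simp [f.injective.eq_iff]) key
    · intro c h1 h2
      rcases key c h1.le (h2.trans (ht _)).le with h | h | h | h <;> subst h
      · exact lt_irrefl _ h1
      · exact lt_irrefl _ h2
      · exact hs _ _ h2
      · exact lt_asymm h2 (ht _)
    · intro c h1 h2
      rcases key c h1.le (h2.trans (ht _)).le with h | h | h | h <;> subst h
      · exact lt_irrefl _ h1
      · exact hs _ _ h2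
      · exact lt_irrefl _ h2
      · exact lt_asymm h2 (ht _)
    · intro c h1 h2
      rcases key c ((hb _).trans h1).le h2.le with h | h | h | h <;> subst h
      · exact lt_asymm h1 (hb _)
      · exact lt_irrefl _ h1
      · exact hs _ _ h1
      · exact lt_irrefl _ h2
    · intro c h1 h2
      rcases key c ((hb _).trans h1).le h2.le with h | h | h | h <;> subst h
      · exact lt_asymm h1 (hb _)
      · exact hs _ _ h1
      · exact lt_irrefl _ h1
      · exact lt_irrefl _ h2
  | succ m ih =>
    intro f p z hf
    obtain ⟨rfl, rfl⟩ := emb_bot (m := m + 1) hf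
    set g := shiftEmb f
    have hlow : ∀ x, f (bot' (m + 1)) < g x := bot_lt_shiftEmb f
    have hup : ∀ x, g x < f (top' (m + 1)) := shiftEmb_lt_top f
    have hg := range_shiftEmb hf
    have key : ∀ x, f (bot' (m + 1)) ≤ x → x ≤ f (top' (m + 1)) →
        x = f (bot' (m + 1)) ∨ x = f (top' (m + 1)) ∨ g (bot' m) ≤ x ∧ x ≤ g (top' m) := by
      intro x h1 h2
      obtain ⟨y, rfl⟩ : x ∈ range f := hf ▸ ⟨h1, h2⟩
      rcases eq_bot_or_top_or_shift y with h | h | ⟨y, rfl⟩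
      · simp [h]
      · simp [h]
      · right; right
        exact ⟨g.le_iff_le.2 (bot'_le y), g.le_iff_le.2 (le_top' y)⟩
    refine .extend (ih g _ _ hg) ⟨hlow _, ?_⟩ ⟨hup _, ?_⟩ key
    · intro c h1 h2
      rcases key c h1.le (h2.trans (hup _)).le with h | h | h
      · exact h1.ne' h
      · exact (h2.trans (hup _)).ne h
      · exact h2.not_ge h.1
    · intro c h1 h2
      rcases key c ((hlow _).trans h1).le h2.le with h | h | h
      · exact ((hlow _).trans h1).ne' h
      · exact h2.ne h
      · exact h1.not_ge h.2

theorem DInt.exists_emb {p z a b : P} (h : DInt p z a b) :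
    ∃ (m : ℕ) (f : DPoset (m + 3) ↪o P), range f = Icc p z ∧
      f (side false) = a ∧ f (side true) = b := by
  induction h with
  | @diamond p a b z h1 h2 h3 h4 h5 h6 =>
    have hab : ¬ a ≤ b := fun h => h1.lt.not_ge
      ((h2.2 h1.lt (lt_of_le_of_ne h h5)).elim)
    have hba : ¬ b ≤ a := fun h => h1.2 h2.lt (lt_of_le_of_ne h h5.symm)
    let F : DPoset 3 → P := fun x => match x with
      | tail _ => p
      | side false => a
      | side true => b
      | neck _ => z
    have hpz : p < z := h1.lt.trans h3.lt
    have hF : ∀ x y, F x ≤ F y ↔ x ≤ y := by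
      intro x y
      have e1 : F (bot' 0) = p := rfl
      have e2 : F (top' 0) = z := rfl
      have e3 : F (side false) = a := rfl
      have e4 : F (side true) = b := rfl
      rcases eq_three x with rfl | rfl | rfl | rfl <;> rcases eq_three y with rfl | rfl | rfl | rfl <;>
        simp only [e1, e2, e3, e4] <;> simp [DPoset.le_iff, bot', top', DPoset.height, hpz.le, hpz.not_ge, h1.le, h2.le,
          h3.le, h4.le, h1.lt.not_ge, h2.lt.not_ge, h3.lt.not_ge, h4.lt.not_ge, hab, hba]
    refine ⟨0, OrderEmbedding.ofMapLEIff F hF, ?_, rfl, rfl⟩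
    ext y
    constructor
    · rintro ⟨x, rfl⟩
      rcases eq_three x with rfl | rfl | rfl | rfl
      · exact ⟨le_rfl, hpz.le⟩
      · exact ⟨hpz.le, le_rfl⟩
      · exact ⟨h1.le, h3.le⟩
      · exact ⟨h2.le, h4.le⟩
    · rintro ⟨hy1, hy2⟩
      rcases h6 y hy1 hy2 with rfl | rfl | rfl | rfl
      · exact ⟨bot' 0, rfl⟩
      · exact ⟨side false, rfl⟩
      · exact ⟨side true, rfl⟩
      · exact ⟨top' 0, rfl⟩
  | @extend t n a b p z h h1 h2 h3 ih =>
    obtain ⟨m, f, hf, rfl, rfl⟩ := ih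
    let F : DPoset (m + 4) → P := fun x => match x with
      | tail i => Fin.cases (n := m + 1) p (fun j => f (tail j)) i
      | side b => f (side b)
      | neck i => Fin.lastCases (n := m + 1) z (fun j => f (neck j)) i
    have e1 : F (bot' (m + 1)) = p := rfl
    have e2 : F (top' (m + 1)) = z := Fin.lastCases_last
    have e3 : ∀ x, F (shift x) = f x := by
      rintro (i | b | i)
      · rfl
      · rfl
      · exact Fin.lastCases_castSucc _
    have hfm : ∀ x, t ≤ f x ∧ f x ≤ n := fun x => by
      have : f x ∈ Icc t n := hf ▸ mem_range_self x
      exact this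
    have hlow : ∀ x, p < f x := fun x => h1.lt.trans_le (hfm x).1
    have hup : ∀ x, f x < z := fun x => (hfm x).2.trans_lt h2.lt
    have hpz : p < z := (hlow (bot' m)).trans (hup _)
    have hF : ∀ x y, F x ≤ F y ↔ x ≤ y := by
      intro x y
      rcases eq_bot_or_top_or_shift x with rfl | rfl | ⟨x, rfl⟩ <;>
        rcases eq_bot_or_top_or_shift y with rfl | rfl | ⟨y, rfl⟩
      · simp
      · simp [e1, e2, hpz.le, bot'_le]
      · simp [e1, e3, (hlow y).le, bot'_le]
      · rw [e1, e2]
        exact iff_of_false hpz.not_ge fun h => bot'_ne_top' (le_antisymm (bot'_le _) h)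
      · simp
      · rw [e2, e3]
        exact iff_of_false (hup y).not_ge fun h => shift_ne_top' y (le_antisymm (le_top' _) h)
      · rw [e1, e3]
        exact iff_of_false (hlow x).not_ge fun h => shift_ne_bot' x (le_antisymm h (bot'_le _))
      · simp [e2, e3, (hup x).le, le_top']
      · rw [e3, e3, f.le_iff_le, shift_le_shift]
    refine ⟨m + 1, OrderEmbedding.ofMapLEIff F hF, ?_, rfl, rfl⟩
    ext y
    constructor
    · rintro ⟨x, rfl⟩
      change F x ∈ _
      rcases eq_bot_or_top_or_shift x with rfl | rfl | ⟨x, rfl⟩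
      · rw [e1]; exact ⟨le_rfl, hpz.le⟩
      · rw [e2]; exact ⟨hpz.le, le_rfl⟩
      · rw [e3]; exact ⟨(hlow x).le, (hup x).le⟩
    · rintro ⟨hy1, hy2⟩
      rcases h3 y hy1 hy2 with rfl | rfl | hy
      · exact ⟨bot' (m + 1), e1⟩
      · exact ⟨top' (m + 1), e2⟩
      · obtain ⟨x, rfl⟩ : y ∈ range f := hf ▸ hy
        exact ⟨shift x, e3 x⟩

theorem exists_emb_of_orderIso {k : ℕ} (hk : 3 ≤ k) {p z : P} (e : Icc p z ≃o DPoset k) :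
    ∃ (m : ℕ) (_ : k = m + 3) (f : DPoset k ↪o P), range f = Icc p z ∧
      ∀ x, f x = (e.symm x : P) := by
  obtain ⟨m, rfl⟩ := Nat.exists_eq_add_of_le' hk
  refine ⟨m, rfl, OrderEmbedding.ofMapLEIff (fun x => (e.symm x : P)) fun x y => ?_, ?_,
    fun _ => rfl⟩
  · rw [Subtype.coe_le_coe, e.symm.le_iff_le]
  · ext y
    constructor
    · rintro ⟨x, rfl⟩; exact (e.symm x).2
    · intro hy; exact ⟨e ⟨y, hy⟩, by simp⟩

theorem orderIso_of_emb {s : Set P} {Q : Type*} [PartialOrder Q] (f : Q ↪o P)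
    (hf : range f = s) : ∃ e : s ≃o Q, ∀ x, ((e.symm x : s) : P) = f x := by
  subst hf
  exact ⟨f.orderIso.symm, fun x => rfl⟩

theorem isDIntervalWithSides_iff {p' w z p : P} :
    IsDIntervalWithSides p' w z p ↔ DInt p' p w z := by
  constructor
  · rintro ⟨k, e, hk, rfl, rfl⟩
    obtain ⟨m, rfl, f, hf, hfe⟩ := exists_emb_of_orderIso hk e
    have := dInt_of_emb m f _ _ hf
    rwa [hfe, hfe] at this
  · intro h
    obtain ⟨m, f, hf, rfl, rfl⟩ := h.exists_emb
    obtain ⟨e, he⟩ := orderIso_of_emb f hf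
    exact ⟨m + 3, e, by omega, he _, he _⟩

theorem isDInterval_iff {p z : P} : IsDInterval p z ↔ ∃ a b, DInt p z a b := by
  constructor
  · rintro ⟨k, hk, ⟨e⟩⟩
    exact ⟨_, _, isDIntervalWithSides_iff.1 ⟨k, e, hk, rfl, rfl⟩⟩
  · rintro ⟨a, b, h⟩
    obtain ⟨k, e, hk, -, -⟩ := isDIntervalWithSides_iff.2 h
    exact ⟨k, hk, ⟨e⟩⟩

end

end DComplete

/-! ### Consequences of the axioms: completing convex sets, and the top determines the bottom -/

namespace DComplete

open DPoset Set

section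

variable {P : Type*} [PartialOrder P]

/-- A neck element is the top of one of the nested smaller diamonds, so being a neck element and
being the top of a `d`-interval amount to the same. -/
theorem exists_dInt_neck (m : ℕ) : ∀ (f : DPoset (m + 3) ↪o P) (p z : P), range f = Icc p z →
    ∀ i : Fin (m + 1), ∃ p' a b, DInt p' (f (neck i)) a b := by
  induction m with
  | zero =>
    intro f p z hf i
    have h := dInt_of_emb 0 f p z hf
    rw [← (emb_bot hf).2] at h
    rw [Subsingleton.elim (α := Fin 1) i (Fin.last 0)]
    exact ⟨_, _, _, h⟩
  | succ m ih =>
    intro f p z hf i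
    rcases Fin.eq_castSucc_or_eq_last i with ⟨j, rfl⟩ | rfl
    · exact ih _ _ _ (range_shiftEmb hf) j
    · have h := dInt_of_emb (m + 1) f p z hf
      rw [← (emb_bot (m := m + 1) hf).2] at h
      exact ⟨_, _, _, h⟩

theorem isNeck_iff {p : P} : IsNeck p ↔ ∃ p' a b, DInt p' p a b := by
  constructor
  · rintro ⟨k, a, b, e, i, hk, rfl⟩
    obtain ⟨m, rfl, f, hf, hfe⟩ := exists_emb_of_orderIso hk e
    rw [← hfe]
    exact exists_dInt_neck m f a b hf i
  · rintro ⟨p', a, b, h⟩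
    obtain ⟨m, f, hf, -, -⟩ := h.exists_emb
    obtain ⟨e, he⟩ := orderIso_of_emb f hf
    exact ⟨m + 3, p', p, e, Fin.last m, by omega, (he _).trans (emb_bot hf).2⟩

theorem isDkMinusConvex_vee {p a b : P} (h1 : p ⋖ a) (h2 : p ⋖ b) (hab : a ≠ b) :
    IsDkMinusConvex 3 {p, a, b} := by
  have hab' : ¬ a ≤ b := fun h => h2.2 h1.lt (lt_of_le_of_ne h hab)
  have hba' : ¬ b ≤ a := fun h => h1.2 h2.lt (lt_of_le_of_ne h hab.symm)
  refine ⟨le_rfl, ⟨?_⟩, ?_⟩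
  · have key : ∀ y, p ≤ y → y ≤ a ∨ y ≤ b → y ∈ ({p, a, b} : Set P) := by
      rintro y hy (h | h)
      · rcases eq_or_lt_of_le hy with rfl | hy
        · simp
        · rcases eq_or_lt_of_le h with rfl | h
          · simp
          · exact (h1.2 hy h).elim
      · rcases eq_or_lt_of_le hy with rfl | hy
        · simp
        · rcases eq_or_lt_of_le h with rfl | h
          · simp
          · exact (h2.2 hy h).elim
    intro x hx y hy z hz
    refine key z ?_ ?_
    · rcases hx with rfl | rfl | rfl
      · exact hz.1
      · exact h1.le.trans hz.1
      · exact h2.le.trans hz.1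
    · rcases hy with rfl | rfl | rfl
      · exact Or.inl (hz.2.trans h1.le)
      · exact Or.inl hz.2
      · exact Or.inr hz.2
  · let F : DPoset 3 → P := fun x => match x with
      | tail _ => p
      | side false => a
      | side true => b
      -- A dummy value: the only neck element of `d_3(1)` is its top, which is removed.
      | neck _ => p
    have e1 : F (bot' 0) = p := rfl
    have e3 : F (side false) = a := rfl
    have e4 : F (side true) = b := rfl
    have hnt : ∀ x : {x : DPoset 3 // ¬ IsTop x}, x.1 = bot' 0 ∨ x.1 = side false ∨
        x.1 = side true := by
      rintro ⟨x, hx⟩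
      rcases eq_three x with rfl | rfl | h | h
      · simp
      · exact (hx (isTop_iff.2 rfl)).elim
      · exact Or.inr (Or.inl h)
      · exact Or.inr (Or.inr h)
    have hF : ∀ x y : {x : DPoset 3 // ¬ IsTop x}, F x.1 ≤ F y.1 ↔ x ≤ y := by
      intro x y
      rw [← Subtype.coe_le_coe]
      rcases hnt x with h | h | h <;> rcases hnt y with h' | h' | h' <;> rw [h, h'] <;>
        simp only [e1, e3, e4] <;>
        simp [DPoset.le_iff, bot', DPoset.height, h1.le, h2.le, h1.lt.not_ge, h2.lt.not_ge, hab',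
          hba']
    have hr : range (OrderEmbedding.ofMapLEIff _ hF) = {p, a, b} := by
      ext y
      constructor
      · rintro ⟨x, rfl⟩
        change F x.1 ∈ _
        rcases hnt x with h | h | h <;> simp only [h, e1, e3, e4] <;> simp
      · rintro (rfl | rfl | rfl)
        · exact ⟨⟨bot' 0, by rw [isTop_iff]; simp [bot', top']⟩, rfl⟩
        · exact ⟨⟨side false, by rw [isTop_iff]; simp [top']⟩, rfl⟩
        · exact ⟨⟨side true, by rw [isTop_iff]; simp [top']⟩, rfl⟩
    exact ⟨(orderIso_of_emb _ hr).choose⟩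

/-- The hypothesis `hc` is exactly what convexity needs: nothing outside `[t, n]` lies between `p`
and `n`. -/
theorem DInt.isDkMinusConvex_insert {t n a b p : P} (h : DInt t n a b) (hp : p ⋖ t)
    (hc : ∀ x, p < x → x ≤ n → t ≤ x) : ∃ k, IsDkMinusConvex k (insert p (Icc t n)) := by
  obtain ⟨m, f, hf, -, -⟩ := h.exists_emb
  refine ⟨m + 4, by omega, ⟨?_⟩, ?_⟩
  · intro x hx y hy z hz
    have hxp : p ≤ x := by
      rcases hx with rfl | hx
      · exact le_rfl
      · exact hp.le.trans hx.1
    have hyn : y ≤ n := by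
      rcases hy with rfl | hy
      · exact hp.le.trans h.lt.le
      · exact hy.2
    rcases eq_or_lt_of_le (hxp.trans hz.1) with h' | h'
    · exact Or.inl h'.symm
    · exact Or.inr ⟨hc z h' (hz.2.trans hyn), hz.2.trans hyn⟩
  · let F : DPoset (m + 4) → P := fun x => match x with
      | tail i => Fin.cases (n := m + 1) p (fun j => f (tail j)) i
      | side b => f (side b)
      -- The value `p` at the top is again a dummy.
      | neck i => Fin.lastCases (n := m + 1) p (fun j => f (neck j)) i
    have e1 : F (bot' (m + 1)) = p := rfl
    have e3 : ∀ x, F (shift x) = f x := by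
      rintro (i | b | i)
      · rfl
      · rfl
      · exact Fin.lastCases_castSucc _
    have hnt : ∀ x : {x : DPoset (m + 4) // ¬ IsTop x}, x.1 = bot' (m + 1) ∨
        ∃ y, x.1 = shift y := by
      rintro ⟨x, hx⟩
      rcases eq_bot_or_top_or_shift x with rfl | rfl | h
      · simp
      · exact (hx (isTop_iff.2 rfl)).elim
      · exact Or.inr h
    have hlow : ∀ x, p < f x := fun x => by
      have : f x ∈ Icc t n := hf ▸ mem_range_self x
      exact hp.lt.trans_le this.1
    have hF : ∀ x y : {x : DPoset (m + 4) // ¬ IsTop x}, F x.1 ≤ F y.1 ↔ x ≤ y := by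
      intro x y
      rw [← Subtype.coe_le_coe]
      rcases hnt x with h | ⟨x', h⟩ <;> rcases hnt y with h' | ⟨y', h'⟩ <;> rw [h, h']
      · simp
      · simp [e1, e3, (hlow y').le, bot'_le]
      · rw [e1, e3]
        exact iff_of_false (hlow x').not_ge fun h => shift_ne_bot' x' (le_antisymm h (bot'_le _))
      · rw [e3, e3, f.le_iff_le, shift_le_shift]
    have hr : range (OrderEmbedding.ofMapLEIff _ hF) = insert p (Icc t n) := by
      ext y
      constructor
      · rintro ⟨x, rfl⟩
        change F x.1 ∈ _
        rcases hnt x with h | ⟨x', h⟩ <;> rw [h]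
        · exact Or.inl e1
        · rw [e3, ← hf]; exact Or.inr (mem_range_self _)
      · rintro (rfl | hy)
        · exact ⟨⟨bot' (m + 1), by rw [isTop_iff]; exact bot'_ne_top'⟩, e1⟩
        · rw [← hf] at hy
          obtain ⟨x, rfl⟩ := hy
          exact ⟨⟨shift x, by rw [isTop_iff]; exact shift_ne_top' x⟩, e3 x⟩
    exact ⟨(orderIso_of_emb _ hr).choose⟩

namespace IsDComplete

variable (hP : IsDComplete P)
include hP

theorem le_of_covBy {p z a b y : P} (h : DInt p z a b) (hy : y ⋖ z) : p ≤ y :=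
  (hP.mem_of_covBy p z (isDInterval_iff.2 ⟨a, b, h⟩) y hy).1

/-- Two bottoms would give two `d_3^-`-convex sets that differ only in their minimal elements,
against the third axiom. -/
theorem eq_of_vee {p p' a b : P} (hab : a ≠ b) (h1 : p ⋖ a) (h2 : p ⋖ b) (h1' : p' ⋖ a)
    (h2' : p' ⋖ b) : p = p' := by
  have key : ∀ q : P, q ⋖ a → q ⋖ b →
      IsLeast {q, a, b} q ∧ ({q, a, b} : Set P) \ {q} = {a, b} := by
    intro q hq hq'
    constructor
    · refine ⟨by simp, ?_⟩
      rintro x (rfl | rfl | rfl)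
      · exact le_rfl
      · exact hq.le
      · exact hq'.le
    · rw [insert_sdiff_self_of_notMem]
      rintro (h | h)
      · exact hq.ne h
      · exact hq'.ne h
  have h := hP.eq_of_sdiff_eq 3 3 _ _ (isDkMinusConvex_vee h1 h2 hab)
    (isDkMinusConvex_vee h1' h2' hab) p p' (key p h1 h2).1 (key p' h1' h2').1
    ((key p h1 h2).2.trans (key p' h1' h2').2.symm)
  have h3 : IsLeast {p, a, b} p' := h ▸ (key p' h1' h2').1
  exact (key p h1 h2).1.unique h3

theorem eq_of_insert {t n a b p p' : P} (h : DInt t n a b) (h1 : p ⋖ t)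
    (hc : ∀ x, p < x → x ≤ n → t ≤ x) (h1' : p' ⋖ t) (hc' : ∀ x, p' < x → x ≤ n → t ≤ x) :
    p = p' := by
  obtain ⟨k, hk⟩ := h.isDkMinusConvex_insert h1 hc
  obtain ⟨l, hl⟩ := h.isDkMinusConvex_insert h1' hc'
  have key : ∀ q : P, q ⋖ t → IsLeast (insert q (Icc t n)) q ∧
      (insert q (Icc t n) : Set P) \ {q} = Icc t n := by
    intro q hq
    constructor
    · refine ⟨by simp, ?_⟩
      rintro x (rfl | hx)
      · exact le_rfl
      · exact hq.le.trans hx.1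
    · rw [insert_sdiff_self_of_notMem]
      exact fun h => hq.lt.not_ge h.1
  have h3 := hP.eq_of_sdiff_eq k l _ _ hk hl p p' (key p h1).1 (key p' h1').1
    ((key p h1).2.trans (key p' h1').2.symm)
  have h4 : IsLeast (insert p (Icc t n)) p' := h3 ▸ (key p' h1').1
  exact (key p h1).1.unique h4

/-- The top of a `d`-interval determines its bottom, and its sides up to order. -/
theorem dInt_unique_of_top {p z a b : P} (h : DInt p z a b) :
    ∀ {p' a' b' : P}, DInt p' z a' b' → p = p' ∧ (a = a' ∧ b = b' ∨ a = b' ∧ b = a') := by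
  induction h with
  | @diamond p a b z h1 h2 h3 h4 h5 h6 =>
    intro p' a' b' h'
    have hd : DInt p z a b := .diamond h1 h2 h3 h4 h5 h6
    cases h' with
    | diamond g1 g2 g3 g4 g5 g6 =>
      -- By the second axiom every element covered by the top lies in the interval. So the top of a
      -- diamond covers exactly two elements and the top of a longer interval exactly one, and the
      -- two types cannot share a top.
      have key : ∀ c, c ⋖ z → c = a ∨ c = b := by
        intro c hc
        rcases h6 c (hP.le_of_covBy hd hc) hc.le with rfl | h | h | h
        · exact (hc.2 h1.lt h3.lt).elim
        · exact Or.inl h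
        · exact Or.inr h
        · exact (hc.ne h).elim
      rcases key a' g3 with rfl | rfl <;> rcases key b' g4 with rfl | rfl
      · exact (g5 rfl).elim
      · exact ⟨hP.eq_of_vee h5 h1 h2 g1 g2, Or.inl ⟨rfl, rfl⟩⟩
      · exact ⟨hP.eq_of_vee h5 h1 h2 g2 g1, Or.inr ⟨rfl, rfl⟩⟩
      · exact (g5 rfl).elim
    | @extend t' n' _ _ _ _ g1 g2 g3 g4 =>
      have hd' : DInt p' z a' b' := .extend g1 g2 g3 g4
      have key : ∀ c, c ⋖ z → c = n' := by
        intro c hc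
        rcases g4 c (hP.le_of_covBy hd' hc) hc.le with rfl | h | h
        · exact (hc.2 (g2.lt.trans_le g1.lt.le) g3.lt).elim
        · exact (hc.ne h).elim
        · exact (eq_or_lt_of_le h.2).resolve_right fun h => hc.2 h g3.lt
      exact (h5 ((key a h3).trans (key b h4).symm)).elim
  | @extend t n a b p z h h2 h3 h4 ih =>
    intro p' a' b' h'
    have hd : DInt p z a b := .extend h h2 h3 h4
    have key : ∀ c, c ⋖ z → c = n := by
      intro c hc
      rcases h4 c (hP.le_of_covBy hd hc) hc.le with rfl | h' | h'
      · exact (hc.2 (h2.lt.trans_le h.lt.le) h3.lt).elim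
      · exact (hc.ne h').elim
      · exact (eq_or_lt_of_le h'.2).resolve_right fun h => hc.2 h h3.lt
    cases h' with
    | diamond g1 g2 g3 g4 g5 g6 =>
      exact (g5 ((key a' g3).trans (key b' g4).symm)).elim
    | @extend t' n' _ _ _ _ g1 g2 g3 g4 =>
      obtain rfl := key n' g3
      obtain ⟨rfl, hs⟩ := ih g1
      refine ⟨hP.eq_of_insert h h2 ?_ g2 ?_, hs⟩
      · intro x hx hx'
        rcases h4 x hx.le (hx'.trans h3.le) with h5 | h5 | h5
        · exact (hx.ne' h5).elim
        · exact (h3.lt.not_ge (h5 ▸ hx')).elim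
        · exact h5.1
      · intro x hx hx'
        rcases g4 x hx.le (hx'.trans h3.le) with h5 | h5 | h5
        · exact (hx.ne' h5).elim
        · exact (h3.lt.not_ge (h5 ▸ hx')).elim
        · exact h5.1

theorem exists_diamond {p a b : P} (h1 : p ⋖ a) (h2 : p ⋖ b) (hab : a ≠ b) :
    ∃ z, a ⋖ z ∧ b ⋖ z ∧ ∀ x, p ≤ x → x ≤ z → x = p ∨ x = a ∨ x = b ∨ x = z := by
  have hab' : ¬ a ≤ b := fun h => h2.2 h1.lt (lt_of_le_of_ne h hab)
  have hba' : ¬ b ≤ a := fun h => h1.2 h2.lt (lt_of_le_of_ne h hab.symm)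
  obtain ⟨z, a', b', hI, -⟩ := hP.exists_completion 3 _ (isDkMinusConvex_vee h1 h2 hab)
  have hmem : ∀ x, (x = z ∨ x = p ∨ x = a ∨ x = b) ↔ a' ≤ x ∧ x ≤ b' := fun x => by
    have := Set.ext_iff.1 hI x
    simpa using this
  have ha := (hmem a).1 (by simp)
  have hb := (hmem b).1 (by simp)
  have hp := (hmem p).1 (by simp)
  have hz := (hmem z).1 (by simp)
  -- The axiom does not say where the completing element sits. It must be the top, since neither
  -- side lies above the other.
  have hbz : b' = z := by
    rcases (hmem b').2 ⟨hz.1.trans hz.2, le_rfl⟩ with h | h | h | h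
    · exact h
    · exact (h1.lt.not_ge (h ▸ ha.2)).elim
    · exact (hba' (h ▸ hb.2)).elim
    · exact (hab' (h ▸ ha.2)).elim
  subst hbz
  have hza : a < b' := lt_of_le_of_ne ha.2 fun h => hba' (h ▸ hb.2)
  have hzb : b < b' := lt_of_le_of_ne hb.2 fun h => hab' (h ▸ ha.2)
  have hx : ∀ x, p ≤ x → x ≤ b' → x = p ∨ x = a ∨ x = b ∨ x = b' := by
    intro x h h'
    have := (hmem x).2 ⟨hp.1.trans h, h'⟩
    tauto
  refine ⟨b', ⟨hza, ?_⟩, ⟨hzb, ?_⟩, hx⟩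
  · intro c hc hc'
    rcases hx c (h1.lt.trans hc).le hc'.le with rfl | rfl | rfl | rfl
    · exact lt_asymm hc h1.lt
    · exact lt_irrefl _ hc
    · exact hab' hc.le
    · exact lt_irrefl _ hc'
  · intro c hc hc'
    rcases hx c (h2.lt.trans hc).le hc'.le with rfl | rfl | rfl | rfl
    · exact lt_asymm hc h2.lt
    · exact hba' hc.le
    · exact lt_irrefl _ hc
    · exact lt_irrefl _ hc'

theorem exists_extend {t n a b p : P} (h : DInt t n a b) (hp : p ⋖ t)
    (hc : ∀ x, p < x → x ≤ n → t ≤ x) :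
    ∃ z, n ⋖ z ∧ ∀ x, p ≤ x → x ≤ z → x = p ∨ x = z ∨ (t ≤ x ∧ x ≤ n) := by
  obtain ⟨k, hk⟩ := h.isDkMinusConvex_insert hp hc
  obtain ⟨z, a', b', hI, hI'⟩ := hP.exists_completion k _ hk
  have hmem : ∀ x, (x = z ∨ x = p ∨ t ≤ x ∧ x ≤ n) ↔ a' ≤ x ∧ x ≤ b' := fun x => by
    have := Set.ext_iff.1 hI x
    simpa using this
  have hn := (hmem n).1 (Or.inr (Or.inr ⟨h.lt.le, le_rfl⟩))
  have hpp := (hmem p).1 (by simp)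
  have hz := (hmem z).1 (by simp)
  have hpt : p < t := hp.lt
  -- If `n` were still the top, then `n` would be the top of two `d`-intervals, one starting at `t`
  -- and one at or below `p`.
  have hbn : b' ≠ n := by
    rintro rfl
    obtain ⟨c, d, h'⟩ := isDInterval_iff.1 ⟨k, hI'⟩
    have := (hP.dInt_unique_of_top h h').1
    exact hpt.not_ge (this ▸ hpp.1)
  have hnb : n < b' := lt_of_le_of_ne hn.2 hbn.symm
  have hbz : b' = z := by
    rcases (hmem b').2 ⟨hz.1.trans hz.2, le_rfl⟩ with h' | h' | h'
    · exact h'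
    · exact ((hpt.trans h.lt).not_ge (h' ▸ hn.2)).elim
    · exact (hnb.not_ge h'.2).elim
  subst hbz
  have hx : ∀ x, p ≤ x → x ≤ b' → x = p ∨ x = b' ∨ (t ≤ x ∧ x ≤ n) := by
    intro x h h'
    have := (hmem x).2 ⟨hpp.1.trans h, h'⟩
    tauto
  refine ⟨b', ⟨hnb, ?_⟩, hx⟩
  intro c hc1 hc2
  rcases hx c ((hpt.trans h.lt).trans hc1).le hc2.le with rfl | rfl | h'
  · exact lt_asymm hc1 (hpt.trans h.lt)
  · exact lt_irrefl _ hc2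
  · exact hc1.not_ge h'.2

end IsDComplete

end

end DComplete

/-! ### The bottom of a `d`-interval determines its top -/

namespace DComplete

open DPoset Set

section

variable {P : Type*} [PartialOrder P]

theorem DInt.not_covBy {p z a b : P} (h : DInt p z a b) : ¬ p ⋖ z :=
  fun h' => h'.2 h.sides.1 h.sides.2.1

namespace IsDComplete

variable (hP : IsDComplete P)
include hP

/-- In a finite `d`-complete poset there are no three distinct elements any two of which are
covered by a common top of a diamond. -/
theorem no_triple [Finite P] (u₁ : P) : ∀ u₂ u₃ p₁ p₂ p₃ : P, u₁ ≠ u₂ → u₁ ≠ u₃ → u₂ ≠ u₃ →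
    p₃ ⋖ u₁ → p₃ ⋖ u₂ → p₂ ⋖ u₁ → p₂ ⋖ u₃ → p₁ ⋖ u₂ → p₁ ⋖ u₃ → False := by
  induction u₁ using (wellFounded_gt (α := P)).induction with
  | _ u₁ ih =>
    intro u₂ u₃ p₁ p₂ p₃ h12 h13 h23 a1 a2 b1 b2 c1 c2
    -- Completing the three vees to diamonds gives three tops, distinct because a top determines its
    -- sides, and any two of them again cover a common element. The configuration climbs forever,
    -- which finiteness forbids.
    obtain ⟨v₃, x1, x2, x3⟩ := hP.exists_diamond a1 a2 h12
    obtain ⟨v₂, y1, y2, y3⟩ := hP.exists_diamond b1 b2 h13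
    obtain ⟨v₁, z1, z2, z3⟩ := hP.exists_diamond c1 c2 h23
    have d3 : DInt p₃ v₃ u₁ u₂ := .diamond a1 a2 x1 x2 h12 x3
    have d2 : DInt p₂ v₂ u₁ u₃ := .diamond b1 b2 y1 y2 h13 y3
    have d1 : DInt p₁ v₁ u₂ u₃ := .diamond c1 c2 z1 z2 h23 z3
    have n32 : v₃ ≠ v₂ := by
      rintro rfl
      rcases (hP.dInt_unique_of_top d3 d2).2 with ⟨_, h⟩ | ⟨h, _⟩
      · exact h23 h
      · exact h13 h
    have n31 : v₃ ≠ v₁ := by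
      rintro rfl
      rcases (hP.dInt_unique_of_top d3 d1).2 with ⟨h, _⟩ | ⟨h, _⟩
      · exact h12 h
      · exact h13 h
    have n21 : v₂ ≠ v₁ := by
      rintro rfl
      rcases (hP.dInt_unique_of_top d2 d1).2 with ⟨h, _⟩ | ⟨_, h⟩
      · exact h12 h
      · exact h23 h.symm
    exact ih v₃ x1.lt v₂ v₁ u₃ u₂ u₁ n32 n31 n21 x1 y1 x2 z1 y2 z2

theorem no_three_covers [Finite P] {p a b c : P} (ha : p ⋖ a) (hb : p ⋖ b) (hc : p ⋖ c)
    (hab : a ≠ b) (hac : a ≠ c) (hbc : b ≠ c) : False :=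
  hP.no_triple a b c p p p hab hac hbc ha hb ha hc hb hc

theorem le_of_lt_diamond [Finite P] {p a b z x : P} (h : DInt p z a b)
    (h6 : ∀ x, p ≤ x → x ≤ z → x = p ∨ x = a ∨ x = b ∨ x = z) (hx : x < z) :
    x ≤ a ∨ x ≤ b := by
  obtain ⟨c, hxc, hc⟩ := exists_le_covBy_of_lt hx
  rcases h6 c (hP.le_of_covBy h hc) hc.le with rfl | rfl | rfl | rfl
  · exact (h.not_covBy hc).elim
  · exact Or.inl hxc
  · exact Or.inr hxc
  · exact (lt_irrefl _ hc.lt).elim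

theorem eq_of_covBy_extend {t n a b p z c : P} (h : DInt t n a b) (h1 : p ⋖ t) (h2 : n ⋖ z)
    (h3 : ∀ x, p ≤ x → x ≤ z → x = p ∨ x = z ∨ (t ≤ x ∧ x ≤ n)) (hc : c ⋖ z) : c = n := by
  have hd : DInt p z a b := .extend h h1 h2 h3
  rcases h3 c (hP.le_of_covBy hd hc) hc.le with rfl | rfl | h
  · exact (hd.not_covBy hc).elim
  · exact (lt_irrefl _ hc.lt).elim
  · exact (eq_or_lt_of_le h.2).resolve_right fun h => hc.2 h h2.lt

theorem le_of_lt_extend [Finite P] {t n a b p z x : P} (h : DInt t n a b) (h1 : p ⋖ t)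
    (h2 : n ⋖ z) (h3 : ∀ x, p ≤ x → x ≤ z → x = p ∨ x = z ∨ (t ≤ x ∧ x ≤ n)) (hx : x < z) :
    x ≤ n := by
  obtain ⟨c, hxc, hc⟩ := exists_le_covBy_of_lt hx
  exact hP.eq_of_covBy_extend h h1 h2 h3 hc ▸ hxc

/-- Two `d`-intervals cannot be stacked at `n` when everything below `Y` is comparable to `n`. If
the lower one is a diamond, its two sides are interchangeable new minima for the upper one, against
the third axiom. Otherwise the inner interval of the lower one and the upper one prolonged by a new
bottom and top form a smaller stack. -/
theorem no_stack [Finite P] {t n a b : P} (h : DInt t n a b) : ∀ {Y c d : P}, DInt n Y c d →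
    (∀ x, x ≤ Y → x ≤ n ∨ n ≤ x) → False := by
  induction h with
  | @diamond p a b z h1 h2 h3 h4 h5 h6 =>
    intro Y c d hY hx
    have key : ∀ a, a ⋖ z → ∀ x, a < x → x ≤ Y → z ≤ x := by
      intro a ha x hax hxY
      rcases hx x hxY with h | h
      · exact ((eq_or_lt_of_le h).resolve_right fun h => ha.2 hax h).ge
      · exact h
    exact h5 (hP.eq_of_insert hY h3 (key a h3) h4 (key b h4))
  | @extend t n a b p z h h2 h3 h4 ih =>
    intro Y c d hY hx
    have hn : ∀ x, n < x → x ≤ Y → z ≤ x := by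
      intro x hax hxY
      rcases hx x hxY with h | h
      · exact ((eq_or_lt_of_le h).resolve_right fun h => h3.2 hax h).ge
      · exact h
    obtain ⟨Y', hY', hY''⟩ := hP.exists_extend hY h3 hn
    refine ih (.extend hY h3 hY' hY'') fun x hxY => ?_
    rcases eq_or_lt_of_le hxY with rfl | hxY
    · exact Or.inr ((h3.lt.trans hY.lt).trans hY'.lt).le
    rcases hx x (hP.le_of_lt_extend hY h3 hY' hY'' hxY) with hxz | hxz
    · rcases eq_or_lt_of_le hxz with rfl | hxz
      · exact Or.inr h3.le
      · exact Or.inl (hP.le_of_lt_extend h h2 h3 h4 hxz)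
    · exact Or.inr (h3.le.trans hxz)

/-- The bottom of a `d`-interval determines its top. -/
theorem dInt_unique_of_bot [Finite P] (p : P) : ∀ {z a b z' a' b' : P}, DInt p z a b →
    DInt p z' a' b' → z = z' := by
  induction p using (wellFounded_gt (α := P)).induction with
  | _ p ih =>
    -- a diamond and a longer interval
    have mixed : ∀ {z a b z' t n c d : P}, p ⋖ a → p ⋖ b → a ⋖ z → b ⋖ z → a ≠ b →
        DInt t n c d → p ⋖ t → n ⋖ z' →
        (∀ x, p ≤ x → x ≤ z' → x = p ∨ x = z' ∨ (t ≤ x ∧ x ≤ n)) → t = a → False := by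
      rintro z a b z' t n c d h1 h2 h3 h4 h5 g1 g2 g3 g4 rfl
      -- Otherwise `b` would lie in the longer interval, whose only atom is `t`.
      have hzn : ¬ z ≤ n := by
        intro hzn
        have hbn : b < n := h4.lt.trans_le hzn
        rcases g4 b h2.le (hbn.le.trans g3.le) with h | h | h
        · exact h2.ne' h
        · exact (hbn.trans g3.lt).ne h
        · exact h2.2 g2.lt (lt_of_le_of_ne h.1 h5)
      cases g1 with
      | diamond k1 k2 k3 k4 k5 k6 =>
        exact hP.no_three_covers h3 k1 k2 (fun h => hzn (h ▸ k3.le)) (fun h => hzn (h ▸ k4.le)) k5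
      | @extend t₂ n₂ _ _ _ _ k1 k2 k3 k4 =>
        have hne : z ≠ t₂ := fun h => hzn (h ▸ k1.lt.le.trans k3.le)
        -- This diamond has the same bottom as the longer interval `[t, n]`, so by induction its top
        -- is `n`, forcing `z ≤ n`.
        obtain ⟨w, x1, x2, x3⟩ := hP.exists_diamond h3 k2 hne
        have := ih _ g2.lt (DInt.diamond h3 k2 x1 x2 hne x3) (.extend k1 k2 k3 k4)
        exact hzn (this ▸ x1.le)
    have mixed' : ∀ {z a b z' t n c d : P}, p ⋖ a → p ⋖ b → a ⋖ z → b ⋖ z → a ≠ b →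
        DInt t n c d → p ⋖ t → n ⋖ z' →
        (∀ x, p ≤ x → x ≤ z' → x = p ∨ x = z' ∨ (t ≤ x ∧ x ≤ n)) → False := by
      intro z a b z' t n c d h1 h2 h3 h4 h5 g1 g2 g3 g4
      by_cases hta : t = a
      · exact mixed h1 h2 h3 h4 h5 g1 g2 g3 g4 hta
      by_cases htb : t = b
      · exact mixed h2 h1 h4 h3 h5.symm g1 g2 g3 g4 htb
      exact hP.no_three_covers h1 h2 g2 h5 (Ne.symm hta) (Ne.symm htb)
    have two : ∀ {a b z z' : P}, a ⋖ z → b ⋖ z → a ⋖ z' → b ⋖ z' → a ≠ b → z = z' := by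
      intro a b z z' h1 h2 h3 h4 hab
      by_contra hne
      exact hab (hP.eq_of_vee hne h1 h3 h2 h4)
    intro z a b z' a' b' h h'
    cases h with
    | diamond h1 h2 h3 h4 h5 h6 =>
      cases h' with
      | diamond g1 g2 g3 g4 g5 g6 =>
        have key : ∀ c, p ⋖ c → c = a ∨ c = b := by
          intro c hc
          by_contra! hcon
          exact hP.no_three_covers h1 h2 hc h5 hcon.1.symm hcon.2.symm
        rcases key a' g1 with rfl | rfl <;> rcases key b' g2 with rfl | rfl
        · exact (g5 rfl).elim
        · exact two h3 h4 g3 g4 h5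
        · exact two h3 h4 g4 g3 h5
        · exact (g5 rfl).elim
      | extend g1 g2 g3 g4 => exact (mixed' h1 h2 h3 h4 h5 g1 g2 g3 g4).elim
    | @extend t n _ _ _ _ h1 h2 h3 h4 =>
      cases h' with
      | diamond g1 g2 g3 g4 g5 g6 => exact (mixed' g1 g2 g3 g4 g5 h1 h2 h3 h4).elim
      | @extend t' n' _ _ _ _ g1 g2 g3 g4 =>
        by_cases htt : t = t'
        · subst htt
          obtain rfl := ih t h2.lt h1 g1
          by_contra hne
          -- Both tops cover the common inner top, so they span a diamond that is stacked on the
          -- inner interval.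
          obtain ⟨Y, y1, y2, y3⟩ := hP.exists_diamond h3 g3 hne
          have hd := DInt.diamond h3 g3 y1 y2 hne y3
          have hlow : ∀ x, x ≤ z → x = z ∨ x ≤ n := fun x hx =>
            (eq_or_lt_of_le hx).imp_right (hP.le_of_lt_extend h1 h2 h3 h4)
          have hlow' : ∀ x, x ≤ z' → x = z' ∨ x ≤ n := fun x hx =>
            (eq_or_lt_of_le hx).imp_right (hP.le_of_lt_extend g1 g2 g3 g4)
          refine hP.no_stack h1 hd fun x hx => ?_
          rcases eq_or_lt_of_le hx with rfl | hx
          · exact Or.inr (h3.lt.trans y1.lt).le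
          rcases hP.le_of_lt_diamond hd y3 hx with h | h
          · rcases hlow x h with rfl | h
            · exact Or.inr h3.le
            · exact Or.inl h
          · rcases hlow' x h with rfl | h
            · exact Or.inr g3.le
            · exact Or.inl h
        · obtain ⟨w, x1, x2, x3⟩ := hP.exists_diamond h2 g2 htt
          exact (mixed' h2 g2 x1 x2 htt h1 h2 h3 h4).elim

end IsDComplete
end
end DComplete

namespace DComplete

open DPoset Set

section

variable {P : Type*} [PartialOrder P]

/-! ### Colours -/

/-- `Nb p z u v`: the interval `[p, z]` is a `d`-interval, and `u`, `v` are the two elements strictly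
inside it whose colours are adjacent to the colour of `p` and `z`. -/
inductive Nb : P → P → P → P → Prop
  | diamond {p a b z : P} : p ⋖ a → p ⋖ b → a ⋖ z → b ⋖ z → a ≠ b →
      (∀ x, p ≤ x → x ≤ z → x = p ∨ x = a ∨ x = b ∨ x = z) → Nb p z a b
  | extend {t n a b p z : P} : DInt t n a b → p ⋖ t → n ⋖ z →
      (∀ x, p ≤ x → x ≤ z → x = p ∨ x = z ∨ (t ≤ x ∧ x ≤ n)) → Nb p z n t

theorem Nb.exists_dInt {p z u v : P} (h : Nb p z u v) : ∃ a b, DInt p z a b := by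
  cases h with
  | diamond h1 h2 h3 h4 h5 h6 => exact ⟨_, _, .diamond h1 h2 h3 h4 h5 h6⟩
  | extend h1 h2 h3 h4 => exact ⟨_, _, .extend h1 h2 h3 h4⟩

theorem DInt.exists_nb {p z a b : P} (h : DInt p z a b) : ∃ u v, Nb p z u v := by
  cases h with
  | diamond h1 h2 h3 h4 h5 h6 => exact ⟨_, _, .diamond h1 h2 h3 h4 h5 h6⟩
  | extend h1 h2 h3 h4 => exact ⟨_, _, .extend h1 h2 h3 h4⟩

theorem diag_eq_iff {x y : P} :
    diag x = diag y ↔ Relation.EqvGen (IsDInterval (P := P)) x y :=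
  Quotient.eq (r := Relation.EqvGen.setoid (IsDInterval (P := P)))

theorem diag_eq_of_isDInterval {x y : P} (h : IsDInterval x y) : diag x = diag y :=
  diag_eq_iff.2 (.rel _ _ h)

theorem DInt.isDInterval {p z a b : P} (h : DInt p z a b) : IsDInterval p z :=
  isDInterval_iff.2 ⟨a, b, h⟩

theorem Nb.isDInterval {p z u v : P} (h : Nb p z u v) : IsDInterval p z :=
  isDInterval_iff.2 h.exists_dInt

theorem IsDInterval.lt {x y : P} (h : IsDInterval x y) : x < y := by
  obtain ⟨a, b, h⟩ := isDInterval_iff.1 h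
  exact h.lt

theorem IsDInterval.exists_nb {x y : P} (h : IsDInterval x y) : ∃ u v, Nb x y u v := by
  obtain ⟨a, b, h⟩ := isDInterval_iff.1 h
  exact h.exists_nb

theorem Nb.lt {p z u v : P} (h : Nb p z u v) : p < z := h.isDInterval.lt

theorem Nb.mem {p z u v : P} (h : Nb p z u v) : p < u ∧ u < z ∧ p < v ∧ v < z ∧ u ≠ v := by
  cases h with
  | diamond h1 h2 h3 h4 h5 h6 => exact ⟨h1.lt, h3.lt, h2.lt, h4.lt, h5⟩
  | extend h1 h2 h3 h4 =>
    exact ⟨h2.lt.trans h1.lt, h3.lt, h2.lt, h1.lt.trans h3.lt, h1.lt.ne'⟩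

theorem le_of_reflTransGen {x y : P} (h : Relation.ReflTransGen (IsDInterval (P := P)) x y) :
    x ≤ y := by
  induction h with
  | refl => exact le_rfl
  | tail _ h ih => exact ih.trans h.lt.le

/-- The colours `k` and `l` are adjacent because of a cover relation inside `U`. -/
def Adj (U : Finset P) (k l : Diagonal P) : Prop :=
  ∃ x ∈ U, ∃ y ∈ U, diag x = k ∧ diag y = l ∧ (x ⋖ y ∨ y ⋖ x)

theorem Adj.symm {U : Finset P} {k l : Diagonal P} (h : Adj U k l) : Adj U l k := by
  obtain ⟨x, hx, y, hy, h1, h2, h3⟩ := h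
  exact ⟨y, hy, x, hx, h2, h1, h3.symm⟩

/-- The induction on which both the heap properties and the polynomials are built: an upper set
arises by adding minimal elements one at a time. -/
theorem upperSet_induction [Finite P] [DecidableEq P] {motive : Finset P → Prop}
    (empty : motive ∅)
    (insert : ∀ (U : Finset P) (p : P), IsUpperSet (U : Set P) → p ∉ U → (∀ c, p < c → c ∈ U) →
      motive U → motive (insert p U)) :
    ∀ U : Finset P, IsUpperSet (U : Set P) → motive U := by
  intro U
  induction U using Finset.strongInduction with
  | H U ih =>
    intro hU
    rcases U.eq_empty_or_nonempty with rfl | hne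
    · exact empty
    obtain ⟨p, hp⟩ := U.exists_minimal hne
    have hU' : IsUpperSet ((U.erase p : Finset P) : Set P) := by
      intro a b hab ha
      simp only [Finset.coe_erase, mem_sdiff, Finset.mem_coe, mem_singleton_iff] at ha ⊢
      refine ⟨hU hab ha.1, ?_⟩
      rintro rfl
      exact ha.2 (le_antisymm hab (hp.2 ha.1 hab))
    have := insert (U.erase p) p hU' (by simp)
      (fun c hc => Finset.mem_erase.2 ⟨hc.ne', hU hc.le hp.1⟩) (ih _ (Finset.erase_ssubset hp.1) hU')
    rwa [Finset.insert_erase hp.1] at this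

namespace IsDComplete

variable (hP : IsDComplete P)
include hP

theorem isDInterval_left_unique {p p' z : P} (h : IsDInterval p z) (h' : IsDInterval p' z) :
    p = p' := by
  obtain ⟨a, b, h⟩ := isDInterval_iff.1 h
  obtain ⟨a', b', h'⟩ := isDInterval_iff.1 h'
  exact (hP.dInt_unique_of_top h h').1

variable [Finite P]

theorem isDInterval_right_unique {p z z' : P} (h : IsDInterval p z) (h' : IsDInterval p z') :
    z = z' := by
  obtain ⟨a, b, h⟩ := isDInterval_iff.1 h
  obtain ⟨a', b', h'⟩ := isDInterval_iff.1 h'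
  exact hP.dInt_unique_of_bot p h h'

/-- Each element has at most one successor and at most one predecessor under the generating
relation, so a class of the generated equivalence is a chain. -/
theorem total_of_diag_eq {x y : P} (h : diag x = diag y) :
    Relation.ReflTransGen (IsDInterval (P := P)) x y ∨
      Relation.ReflTransGen (IsDInterval (P := P)) y x := by
  rw [diag_eq_iff] at h
  induction h with
  | rel x y h => exact Or.inl (.single h)
  | refl x => exact Or.inl .refl
  | symm x y _ ih => exact ih.symm
  | trans x y z _ _ h1 h2 =>
    rcases h1 with h1 | h1 <;> rcases h2 with h2 | h2
    · exact Or.inl (h1.trans h2)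
    · have hU : Relator.RightUnique (Function.swap (IsDInterval (P := P))) :=
        fun _ _ _ h h' => hP.isDInterval_left_unique h h'
      rcases Relation.ReflTransGen.total_of_right_unique hU
        (Relation.reflTransGen_swap.2 h1) (Relation.reflTransGen_swap.2 h2) with h | h
      · exact Or.inr (Relation.reflTransGen_swap.1 h)
      · exact Or.inl (Relation.reflTransGen_swap.1 h)
    · exact Relation.ReflTransGen.total_of_right_unique
        (fun _ _ _ h h' => hP.isDInterval_right_unique h h') h1 h2
    · exact Or.inr (h2.trans h1)

theorem comparable_of_diag_eq {x y : P} (h : diag x = diag y) : x ≤ y ∨ y ≤ x :=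
  (hP.total_of_diag_eq h).imp le_of_reflTransGen le_of_reflTransGen

theorem exists_next {x y : P} (h : diag x = diag y) (hxy : x < y) :
    ∃ z, IsDInterval x z ∧ z ≤ y := by
  rcases hP.total_of_diag_eq h with h | h
  · rcases h.cases_head with rfl | ⟨z, h1, h2⟩
    · exact (lt_irrefl _ hxy).elim
    · exact ⟨z, h1, le_of_reflTransGen h2⟩
  · exact ((le_of_reflTransGen h).not_gt hxy).elim

theorem exists_prev {x y : P} (h : diag x = diag y) (hxy : x < y) :
    ∃ z, IsDInterval z y ∧ x ≤ z := by
  rcases hP.total_of_diag_eq h with h | h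
  · rcases h.cases_tail with rfl | ⟨z, h1, h2⟩
    · exact (lt_irrefl _ hxy).elim
    · exact ⟨z, h2, le_of_reflTransGen h1⟩
  · exact ((le_of_reflTransGen h).not_gt hxy).elim

theorem diag_ne_of_covBy {x y : P} (h : x ⋖ y) : diag x ≠ diag y := by
  intro h'
  obtain ⟨z, hz, hzy⟩ := hP.exists_next h' h.lt
  rcases eq_or_lt_of_le hzy with rfl | hzy
  · obtain ⟨a, b, hd⟩ := isDInterval_iff.1 hz
    exact hd.not_covBy h
  · exact h.2 hz.lt hzy

theorem adj_ne {U : Finset P} {k l : Diagonal P} (h : Adj U k l) : k ≠ l := by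
  obtain ⟨x, -, y, -, rfl, rfl, h | h⟩ := h
  · exact hP.diag_ne_of_covBy h
  · exact (hP.diag_ne_of_covBy h).symm

theorem nb_eq_of_covBy {p z u v c : P} (h : Nb p z u v) (hc : p ⋖ c) : c = u ∨ c = v := by
  cases h with
  | diamond h1 h2 h3 h4 h5 h6 =>
    by_contra! hcon
    exact hP.no_three_covers h1 h2 hc h5 hcon.1.symm hcon.2.symm
  | extend h1 h2 h3 h4 =>
    right
    by_contra hne
    obtain ⟨w, x1, x2, x3⟩ := hP.exists_diamond hc h2 hne
    obtain rfl := hP.dInt_unique_of_bot p (.diamond hc h2 x1 x2 hne x3) (.extend h1 h2 h3 h4)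
    obtain rfl := hP.eq_of_covBy_extend h1 h2 h3 h4 x1
    exact hc.2 h2.lt h1.lt

/-- Covers at the bottom of a `d`-interval repeat, in colour, covers at its top. Adding the bottom
therefore creates no new adjacency of colours. -/
theorem exists_covBy_top {p z u v c : P} (h : Nb p z u v) (hc : p ⋖ c) :
    ∃ c', c' ⋖ z ∧ diag c' = diag c ∧ p < c' := by
  rcases hP.nb_eq_of_covBy h hc with rfl | rfl
  · cases h with
    | diamond h1 h2 h3 h4 h5 h6 => exact ⟨_, h3, rfl, h1.lt⟩
    | extend h1 h2 h3 h4 => exact ⟨_, h3, rfl, hc.lt⟩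
  · cases h with
    | diamond h1 h2 h3 h4 h5 h6 => exact ⟨_, h4, rfl, h2.lt⟩
    | extend h1 h2 h3 h4 =>
      exact ⟨_, h3, (diag_eq_of_isDInterval h1.isDInterval).symm, h2.lt.trans h1.lt⟩

end IsDComplete

/-- The compatibility properties of the colours within an upper set `U`. -/
structure IsHeap (U : Finset P) : Prop where
  comp : ∀ x ∈ U, ∀ y ∈ U, Adj U (diag x) (diag y) → x ≤ y ∨ y ≤ x
  nb : ∀ p ∈ U, ∀ z u v, Nb p z u v → ∀ y ∈ U, Adj U (diag p) (diag y) → p < y → y < z →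
    y = u ∨ y = v
  top : ∀ p ∈ U, (¬ ∃ z, IsDInterval p z) → ∀ y ∈ U, ∀ y' ∈ U, Adj U (diag p) (diag y) →
    Adj U (diag p) (diag y') → p < y → p < y' → y = y'

variable [DecidableEq P] {U : Finset P} {p : P}

theorem adj_insert (hU : IsUpperSet (U : Set P)) (hpU : p ∉ U) {k l : Diagonal P}
    (h : Adj (insert p U) k l) : Adj U k l ∨ (k = diag p ∧ ∃ c, p ⋖ c ∧ l = diag c) ∨
      (l = diag p ∧ ∃ c, p ⋖ c ∧ k = diag c) := by
  have hnot : ∀ y ∈ U, ¬ y < p := fun y hy hyp => hpU (hU hyp.le hy)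
  obtain ⟨x, hx, y, hy, rfl, rfl, h⟩ := h
  rw [Finset.mem_insert] at hx hy
  rcases hx with rfl | hx <;> rcases hy with rfl | hy
  · simp at h
  · rcases h with h | h
    · exact Or.inr (Or.inl ⟨rfl, y, h, rfl⟩)
    · exact (hnot y hy h.lt).elim
  · rcases h with h | h
    · exact (hnot x hx h.lt).elim
    · exact Or.inr (Or.inr ⟨rfl, x, h, rfl⟩)
  · exact Or.inl ⟨x, hx, y, hy, rfl, rfl, h⟩

/-! ### Heap properties are preserved when a minimal element is added -/

namespace IsDComplete

variable [Finite P] (hP : IsDComplete P)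
include hP

/-- Here `p` brings a new colour and has at most one cover `c`, since two covers would span a
diamond. A further element of the colour of `c` would give a `d`-interval starting at `c`, which
could be prolonged to one starting at `p`. -/
theorem isHeap_insert_of_top (hU : IsUpperSet (U : Set P)) (hpU : p ∉ U)
    (hp : ∀ c, p < c → c ∈ U) (G : IsHeap U) (htop : ¬ ∃ z, IsDInterval p z) :
    IsHeap (insert p U) := by
  have hnot : ∀ y ∈ U, ¬ y < p := fun y hy hyp => hpU (hU hyp.le hy)
  have hcol : ∀ y ∈ U, diag y ≠ diag p := by
    intro y hy h
    rcases hP.comparable_of_diag_eq h with h' | h'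
    · exact hpU (hU h' hy)
    · obtain ⟨z, hz, -⟩ := hP.exists_next h.symm
        (lt_of_le_of_ne h' (by rintro rfl; exact hpU hy))
      exact htop ⟨z, hz⟩
  have hcov : ∀ c c', p ⋖ c → p ⋖ c' → c = c' := by
    intro c c' hc hc'
    by_contra hne
    obtain ⟨w, x1, x2, x3⟩ := hP.exists_diamond hc hc' hne
    exact htop ⟨w, (DInt.diamond hc hc' x1 x2 hne x3).isDInterval⟩
  have hadj : ∀ x ∈ U, ∀ y ∈ U, Adj (insert p U) (diag x) (diag y) → Adj U (diag x) (diag y) := by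
    intro x hx y hy h
    rcases adj_insert hU hpU h with h | ⟨h, -⟩ | ⟨h, -⟩
    · exact h
    · exact (hcol x hx h).elim
    · exact (hcol y hy h).elim
  have hadjp : ∀ y ∈ U, Adj (insert p U) (diag p) (diag y) → ∃ c, p ⋖ c ∧ diag y = diag c := by
    intro y hy h
    rcases adj_insert hU hpU h with ⟨x, hx, y', hy', h1, h2, h3⟩ | ⟨-, h⟩ | ⟨h, -⟩
    · exact (hcol x hx h1).elim
    · exact h
    · exact (hcol y hy h).elim
  have hge : ∀ y ∈ U, ∀ c, p ⋖ c → diag y = diag c → c ≤ y := by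
    intro y hy c hc h
    rcases hP.comparable_of_diag_eq h with h' | h'
    · rcases eq_or_lt_of_le h' with rfl | h'
      · exact le_rfl
      -- The predecessor of `c` in its diagonal lies below everything `c` covers, hence below `p`,
      -- so it is outside `U`.
      · obtain ⟨w, hw, hyw⟩ := hP.exists_prev h h'
        obtain ⟨a, b, hw⟩ := isDInterval_iff.1 hw
        exact (hpU (hU (hyw.trans (hP.le_of_covBy hw hc)) hy)).elim
    · exact h'
  refine ⟨?_, ?_, ?_⟩
  · intro x hx y hy h
    rw [Finset.mem_insert] at hx hy
    rcases hx with rfl | hx <;> rcases hy with rfl | hy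
    · exact Or.inl le_rfl
    · obtain ⟨c, hc, h⟩ := hadjp y hy h
      exact Or.inl (hc.le.trans (hge y hy c hc h))
    · obtain ⟨c, hc, h⟩ := hadjp x hx h.symm
      exact Or.inr (hc.le.trans (hge x hx c hc h))
    · exact G.comp x hx y hy (hadj x hx y hy h)
  · intro q hq z u v hnb y hy hA hqy hyz
    rw [Finset.mem_insert] at hq hy
    rcases hq with rfl | hq
    · exact (htop ⟨z, hnb.isDInterval⟩).elim
    rcases hy with rfl | hy
    · exact (hnot q hq hqy).elim
    exact G.nb q hq z u v hnb y hy (hadj q hq y hy hA) hqy hyz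
  · intro q hq hqt y hy y' hy' hA hA' hqy hqy'
    rw [Finset.mem_insert] at hq hy hy'
    rcases hq with rfl | hq
    · have key : ∀ y, q < y → Adj (insert q U) (diag q) (diag y) → q ⋖ y := by
        intro y hqy hA
        obtain ⟨c, hc, h⟩ := hadjp y (hp y hqy) hA
        have hcy := hge y (hp y hqy) c hc h
        rcases eq_or_lt_of_le hcy with rfl | hcy
        · exact hc
        obtain ⟨z, hz, -⟩ := hP.exists_next h.symm hcy
        obtain ⟨a, b, hz⟩ := isDInterval_iff.1 hz
        have hconv : ∀ x, q < x → x ≤ z → c ≤ x := by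
          intro x hx _
          obtain ⟨c', hc', hcx⟩ := exists_covBy_le_of_lt hx
          exact hcov c' c hc' hc ▸ hcx
        obtain ⟨w, hw, hw'⟩ := hP.exists_extend hz hc hconv
        exact (htop ⟨w, (DInt.extend hz hc hw hw').isDInterval⟩).elim
      exact hcov _ _ (key y hqy hA) (key y' hqy' hA')
    have hy1 : y ∈ U := hU hqy.le hq
    have hy2 : y' ∈ U := hU hqy'.le hq
    exact G.top q hq hqt y hy1 y' hy2 (hadj q hq y hy1 hA) (hadj q hq y' hy2 hA') hqy hqy'

/-- The idea is to look at the highest element `y₀` below `z` of the colour of `y`. If `z` covers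
`y₀`, then `y₀` lies in `[p, z]`, and walking down its diagonal leaves `U` as soon as `p` is passed.
If not, `y₀` lies below two comparable elements of adjacent colours, a cover `c` and `z`, which the
heap properties of `U` exclude. -/
theorem eq_of_adj_of_lt (hU : IsUpperSet (U : Set P)) (hpU : p ∉ U)
    (hp : ∀ c, p < c → c ∈ U) (G : IsHeap U) {z u v : P} (hnb : Nb p z u v) {y : P} (hy : y ∈ U)
    (hA : Adj U (diag z) (diag y)) (hyz : y < z) : y = u ∨ y = v := by
  have hzU : z ∈ U := hp z hnb.lt
  obtain ⟨y₀, hyy, ⟨hy₀, hyz₀⟩, hmax⟩ := exists_maximal_ge_of_wellFoundedGT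
    (fun w => diag w = diag y ∧ w < z) y ⟨rfl, hyz⟩
  have hy₀U : y₀ ∈ U := hU hyy hy
  obtain ⟨c, hc, hcz⟩ := exists_covBy_le_of_lt hyz₀
  have hcU : c ∈ U := hU hc.le hy₀U
  have hAc : Adj U (diag y₀) (diag c) := ⟨y₀, hy₀U, c, hcU, rfl, rfl, Or.inl hc⟩
  have hAz : Adj U (diag y₀) (diag z) := hy₀ ▸ hA.symm
  have hprev : ∀ w w', p ⋖ w → IsDInterval w' w → w' ∉ U := by
    intro w w' hw hw' hw'U
    obtain ⟨a, b, hw'⟩ := isDInterval_iff.1 hw'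
    exact hpU (hU (hP.le_of_covBy hw' hw) hw'U)
  rcases eq_or_lt_of_le hcz with rfl | hcz
  · have hpy : p ≤ y₀ := by
      obtain ⟨a, b, h⟩ := hnb.exists_dInt
      exact hP.le_of_covBy h hc
    cases hnb with
    | diamond h1 h2 h3 h4 h5 h6 =>
      have key : ∀ w, p ⋖ w → y₀ = w → y = w := by
        rintro w hw rfl
        by_contra hne
        obtain ⟨w', hw', hyw'⟩ := hP.exists_prev hy₀.symm (lt_of_le_of_ne hyy hne)
        exact hprev _ w' hw hw' (hU hyw' hy)
      rcases h6 y₀ hpy hc.le with h | h | h | h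
      · exact (hpU (h ▸ hy₀U)).elim
      · exact Or.inl (key _ h1 h)
      · exact Or.inr (key _ h2 h)
      · exact (hc.ne h).elim
    | extend h1 h2 h3 h4 =>
      obtain rfl := hP.eq_of_covBy_extend h1 h2 h3 h4 hc
      by_cases hne : y = y₀
      · exact Or.inl hne
      right
      obtain ⟨w, hw, hyw⟩ := hP.exists_prev hy₀.symm (lt_of_le_of_ne hyy hne)
      obtain rfl := hP.isDInterval_left_unique hw h1.isDInterval
      by_contra hne'
      obtain ⟨w', hw', hyw'⟩ := hP.exists_prev
        (hy₀.symm.trans (diag_eq_of_isDInterval hw).symm) (lt_of_le_of_ne hyw hne')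
      exact hprev _ w' h2 hw' (hU hyw' hy)
  · exfalso
    by_cases hex : ∃ y₁, IsDInterval y₀ y₁
    · obtain ⟨y₁, h₁⟩ := hex
      obtain ⟨u', v', hnb'⟩ := h₁.exists_nb
      have hd := diag_eq_of_isDInterval h₁
      have hzy : z < y₁ := by
        rcases G.comp z hzU y₁ (hU h₁.lt.le hy₀U) (hd ▸ hAz.symm) with h | h
        · exact lt_of_le_of_ne h fun h => hP.adj_ne hAz (hd.trans (h ▸ rfl))
        · rcases eq_or_lt_of_le h with h | h
          · exact (hP.adj_ne hAz (hd.trans (h ▸ rfl))).elim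
          -- The successor `y₁` must lie above `z` by maximality of `y₀`, so both `c` and `z` are
          -- neighbours in the interval `[y₀, y₁]`.
          · exact ((hmax ⟨hd.symm.trans hy₀, h⟩ h₁.lt.le).not_gt h₁.lt).elim
      have hc' := G.nb y₀ hy₀U y₁ u' v' hnb' c hcU hAc hc.lt (hcz.trans hzy)
      have hz' := G.nb y₀ hy₀U y₁ u' v' hnb' z hzU hAz hyz₀ hzy
      cases hnb' with
      | diamond h1 h2 h3 h4 h5 h6 =>
        rcases hc' with rfl | rfl
        · exact h3.2 hcz hzy
        · exact h4.2 hcz hzy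
      | extend h1 h2 h3 h4 =>
        rcases hc' with rfl | rfl <;> rcases hz' with rfl | rfl
        · exact lt_irrefl _ hcz
        · exact lt_asymm hcz h1.lt
        -- In this case `[c, z]` is the inner `d`-interval, so `c` is the bottom `p` of the
        -- `d`-interval with top `z`.
        · exact hpU (hP.isDInterval_left_unique hnb.isDInterval h1.isDInterval ▸ hcU)
        · exact lt_irrefl _ hcz
    · exact hcz.ne (G.top y₀ hy₀U hex c hcU z hzU hAc hAz hc.lt hyz₀)

theorem isHeap_insert_of_nb (hU : IsUpperSet (U : Set P)) (hpU : p ∉ U)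
    (hp : ∀ c, p < c → c ∈ U) (G : IsHeap U) {z : P} (hz : IsDInterval p z) :
    IsHeap (insert p U) := by
  have hzU : z ∈ U := hp z hz.lt
  have hd := diag_eq_of_isDInterval hz
  have hnot : ∀ y ∈ U, ¬ y < p := fun y hy hyp => hpU (hU hyp.le hy)
  have hadjc : ∀ c, p ⋖ c → Adj U (diag p) (diag c) := by
    intro c hc
    obtain ⟨u, v, hnb⟩ := hz.exists_nb
    obtain ⟨c', hc', h, hpc⟩ := hP.exists_covBy_top hnb hc
    exact ⟨z, hzU, c', hp c' hpc, hd.symm, h, Or.inr hc'⟩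
  have hadj : ∀ k l, Adj (insert p U) k l → Adj U k l := by
    intro k l h
    rcases adj_insert hU hpU h with h | ⟨rfl, c, hc, rfl⟩ | ⟨rfl, c, hc, rfl⟩
    · exact h
    · exact hadjc c hc
    · exact (hadjc c hc).symm
  have hcomp : ∀ y ∈ U, Adj U (diag p) (diag y) → p ≤ y := by
    intro y hy hA
    rw [hd] at hA
    rcases G.comp z hzU y hy hA with h | h
    · exact hz.lt.le.trans h
    · rcases eq_or_lt_of_le h with rfl | h
      · exact hz.lt.le
      obtain ⟨u, v, hnb⟩ := hz.exists_nb
      rcases hP.eq_of_adj_of_lt hU hpU hp G hnb hy hA h with rfl | rfl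
      · exact hnb.mem.1.le
      · exact hnb.mem.2.2.1.le
  refine ⟨?_, ?_, ?_⟩
  · intro x hx y hy h
    have h' := hadj _ _ h
    rw [Finset.mem_insert] at hx hy
    rcases hx with rfl | hx <;> rcases hy with rfl | hy
    · exact Or.inl le_rfl
    · exact Or.inl (hcomp y hy h')
    · exact Or.inr (hcomp x hx h'.symm)
    · exact G.comp x hx y hy h'
  · intro q hq z' u v hnb y hy hA hqy hyz
    have hA' := hadj _ _ hA
    rw [Finset.mem_insert] at hq
    rcases hq with rfl | hq
    · obtain rfl := hP.isDInterval_right_unique hz hnb.isDInterval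
      exact hP.eq_of_adj_of_lt hU hpU hp G hnb (hp y hqy) (hd ▸ hA') hyz
    exact G.nb q hq z' u v hnb y (hU hqy.le hq) hA' hqy hyz
  · intro q hq hqt y hy y' hy' hA hA' hqy hqy'
    rw [Finset.mem_insert] at hq
    rcases hq with rfl | hq
    · exact (hqt ⟨z, hz⟩).elim
    exact G.top q hq hqt y (hU hqy.le hq) y' (hU hqy'.le hq) (hadj _ _ hA) (hadj _ _ hA') hqy hqy'

theorem isHeap : ∀ U : Finset P, IsUpperSet (U : Set P) → IsHeap U := by
  refine upperSet_induction ⟨by simp, by simp, by simp⟩ fun U p hU hpU hp G => ?_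
  by_cases htop : ∃ z, IsDInterval p z
  · obtain ⟨z, hz⟩ := htop
    exact hP.isHeap_insert_of_nb hU hpU hp G hz
  · exact hP.isHeap_insert_of_top hU hpU hp G htop

end IsDComplete
end
end DComplete

namespace DComplete

/-! ### Heaps of colours -/

/-- The properties of a coloured poset that the proof of the hook formula needs. Here
`nb p z u v` says that `p < z` are consecutive elements of the same colour, and that `u`, `v` are
the elements between them of an adjacent colour. -/
structure Coloring {P ι : Type*} [PartialOrder P] (col : P → ι) (adj : ι → ι → Prop)
    (nb : P → P → P → P → Prop) : Prop where
  adj_symm : ∀ {k l}, adj k l → adj l k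
  adj_irrefl : ∀ k, ¬ adj k k
  comp_eq : ∀ {x y}, col x = col y → x ≤ y ∨ y ≤ x
  comp_adj : ∀ {x y}, adj (col x) (col y) → x ≤ y ∨ y ≤ x
  adj_of_covBy : ∀ {x y}, x ⋖ y → adj (col x) (col y)
  nb_mem : ∀ {p z u v}, nb p z u v → p < u ∧ u < z ∧ p < v ∧ v < z ∧ u ≠ v
  nb_col : ∀ {p z u v}, nb p z u v → col p = col z
  nb_adj : ∀ {p z u v}, nb p z u v → adj (col p) (col u) ∧ adj (col p) (col v)
  nb_eq : ∀ {p z u v y}, nb p z u v → adj (col p) (col y) → p < y → y < z → y = u ∨ y = v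
  nb_ne : ∀ {p z u v y}, nb p z u v → p < y → y < z → col y ≠ col p
  exists_next : ∀ {x y}, col x = col y → x < y → ∃ z u v, nb x z u v ∧ z ≤ y
  exists_prev : ∀ {x y}, col x = col y → x < y → ∃ z u v, nb z y u v ∧ x ≤ z
  top : ∀ {p}, (¬ ∃ z u v, nb p z u v) → ∀ {y y'}, adj (col p) (col y) → adj (col p) (col y') →
    p < y → p < y' → y = y'

theorem IsDComplete.coloring {P : Type*} [PartialOrder P] [Fintype P] (hP : IsDComplete P) :
    Coloring (diag (P := P)) (Adj Finset.univ) Nb := by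
  classical
  have G := hP.isHeap Finset.univ (by simpa using isUpperSet_univ)
  have hcov : ∀ {x y : P}, x ⋖ y → Adj Finset.univ (diag x) (diag y) := fun {x y} h =>
    ⟨x, by simp, y, by simp, rfl, rfl, Or.inl h⟩
  refine
    { adj_symm := fun h => h.symm
      adj_irrefl := fun k h => hP.adj_ne h rfl
      comp_eq := fun h => hP.comparable_of_diag_eq h
      comp_adj := fun h => G.comp _ (by simp) _ (by simp) h
      adj_of_covBy := hcov
      nb_mem := fun h => h.mem
      nb_col := fun h => diag_eq_of_isDInterval h.isDInterval
      nb_adj := ?_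
      nb_eq := fun h hA h1 h2 => G.nb _ (by simp) _ _ _ h _ (by simp) hA h1 h2
      nb_ne := ?_
      exists_next := ?_
      exists_prev := ?_
      top := ?_ }
  · intro p z u v h
    cases h with
    | diamond h1 h2 h3 h4 h5 h6 => exact ⟨hcov h1, hcov h2⟩
    | extend h1 h2 h3 h4 =>
      exact ⟨diag_eq_of_isDInterval h1.isDInterval ▸ hcov h2, hcov h2⟩
  · intro p z u v y h hpy hyz hd
    obtain ⟨z', hz', hzy⟩ := hP.exists_next hd.symm hpy
    exact (hzy.trans_lt hyz).ne (hP.isDInterval_right_unique hz' h.isDInterval)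
  · intro x y h hxy
    obtain ⟨z, hz, hzy⟩ := hP.exists_next h hxy
    obtain ⟨u, v, hn⟩ := hz.exists_nb
    exact ⟨z, u, v, hn, hzy⟩
  · intro x y h hxy
    obtain ⟨z, hz, hzy⟩ := hP.exists_prev h hxy
    obtain ⟨u, v, hn⟩ := hz.exists_nb
    exact ⟨z, u, v, hn, hzy⟩
  · intro p hp y y' hA hA' h h'
    refine G.top p (by simp) ?_ y (by simp) y' (by simp) hA hA' h h'
    rintro ⟨z, hz⟩
    obtain ⟨u, v, hn⟩ := hz.exists_nb
    exact hp ⟨z, u, v, hn⟩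

/-! ### Cartan integers and weights of upper sets -/

section

open scoped Classical

variable {P ι : Type*} [PartialOrder P] {col : P → ι} {adj : ι → ι → Prop}
  {nb : P → P → P → P → Prop}

/-- The negative of the Cartan integer of two colours. -/
noncomputable def mult (adj : ι → ι → Prop) (k l : ι) : ℤ :=
  if l = k then -2 else if adj k l then 1 else 0

theorem mult_self (k : ι) : mult adj k k = -2 := by simp [mult]

theorem mult_nonneg {k l : ι} (h : l ≠ k) : 0 ≤ mult adj k l := by
  rw [mult, if_neg h]; split_ifs <;> simp

omit [PartialOrder P] in
/-- If the colour `k` does not occur in `B`, the multiplicities just count adjacent elements. -/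
theorem sum_mult_eq_card (B : Finset P) (k : ι) (h : ∀ y ∈ B, col y ≠ k) :
    ∑ y ∈ B, mult adj k (col y) = ((B.filter fun y => adj k (col y)).card : ℤ) := by
  rw [Finset.card_filter, Nat.cast_sum]
  refine Finset.sum_congr rfl fun y hy => ?_
  rw [mult, if_neg (h y hy)]
  split_ifs <;> simp

theorem sum_split_self {x : P} (A : Finset P) (hx : x ∈ A) :
    ∑ y ∈ A with x ≤ y, mult adj (col x) (col y) =
      -2 + ∑ y ∈ A with x < y, mult adj (col x) (col y) := by
  rw [show (A.filter fun y => x ≤ y) = insert x (A.filter fun y => x < y) by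
    ext y
    simp only [Finset.mem_filter, Finset.mem_insert, le_iff_eq_or_lt]
    constructor
    · rintro ⟨h, rfl | h'⟩
      · exact Or.inl rfl
      · exact Or.inr ⟨h, h'⟩
    · rintro (rfl | ⟨h, h'⟩)
      · exact ⟨hx, Or.inl rfl⟩
      · exact ⟨h, Or.inr h'⟩]
  rw [Finset.sum_insert (by simp), mult_self]

theorem sum_split_self' {x : P} (A : Finset P) (hx : x ∈ A) :
    ∑ y ∈ A with y ≤ x, mult adj (col x) (col y) =
      -2 + ∑ y ∈ A with y < x, mult adj (col x) (col y) := by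
  rw [show (A.filter fun y => y ≤ x) = insert x (A.filter fun y => y < x) by
    ext y
    simp only [Finset.mem_filter, Finset.mem_insert, le_iff_eq_or_lt]
    constructor
    · rintro ⟨h, rfl | h'⟩
      · exact Or.inl rfl
      · exact Or.inr ⟨h, h'⟩
    · rintro (rfl | ⟨h, h'⟩)
      · exact ⟨hx, Or.inl rfl⟩
      · exact ⟨h, Or.inr h'⟩]
  rw [Finset.sum_insert (by simp), mult_self]

namespace Coloring

variable (H : Coloring col adj nb)
include H

theorem mult_of_adj {k l : ι} (h : adj k l) : mult adj k l = 1 := by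
  rw [mult, if_neg, if_pos h]
  rintro rfl
  exact H.adj_irrefl _ h

theorem mult_comm (k l : ι) : mult adj k l = mult adj l k := by
  have : adj k l ↔ adj l k := ⟨H.adj_symm, H.adj_symm⟩
  simp only [mult, this, eq_comm]

theorem mult_eq_zero {x y : P} (h1 : ¬ x ≤ y) (h2 : ¬ y ≤ x) : mult adj (col x) (col y) = 0 := by
  rw [mult, if_neg, if_neg]
  · exact fun h => (H.comp_adj h).elim h1 h2
  · exact fun h => (H.comp_eq h).elim h2 h1

/-- Only `p`, `u` and `v` contribute, with `-2 + 1 + 1`; an element not below `z` is incomparable to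
`z` and so has multiplicity zero. -/
theorem sum_Ico {p z u v : P} (h : nb p z u v) (A : Finset P) (hp : p ∈ A) (hu : u ∈ A)
    (hv : v ∈ A) : ∑ y ∈ A with p ≤ y ∧ ¬ z ≤ y, mult adj (col p) (col y) = 0 := by
  obtain ⟨h1, h2, h3, h4, h5⟩ := H.nb_mem h
  have hs : ({p, u, v} : Finset P) ⊆ A.filter fun y => p ≤ y ∧ ¬ z ≤ y := by
    intro y hy
    simp only [Finset.mem_insert, Finset.mem_singleton] at hy
    rcases hy with rfl | rfl | rfl
    · simp [hp, (h1.trans h2).not_ge]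
    · simp [hu, h1.le, h2.not_ge]
    · simp [hv, h3.le, h4.not_ge]
  rw [← Finset.sum_subset hs, Finset.sum_insert, Finset.sum_insert, Finset.sum_singleton,
    mult_self, H.mult_of_adj (H.nb_adj h).1, H.mult_of_adj (H.nb_adj h).2]
  · norm_num
  · simpa using h5
  · simp [h1.ne, h3.ne]
  · intro y hy hy'
    simp only [Finset.mem_filter, Finset.mem_insert, Finset.mem_singleton, not_or] at hy hy'
    have hpy : p < y := lt_of_le_of_ne hy.2.1 (Ne.symm hy'.1)
    by_cases hyz : y ≤ z
    · have hyz : y < z := lt_of_le_of_ne hyz (fun h => hy.2.2 h.ge)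
      rw [mult, if_neg (H.nb_ne h hpy hyz), if_neg]
      intro hA
      rcases H.nb_eq h hA hpy hyz with h | h
      · exact hy'.2.1 h
      · exact hy'.2.2 h
    · rw [H.nb_col h]
      exact H.mult_eq_zero hy.2.2 hyz

theorem sum_Ioc {p z u v : P} (h : nb p z u v) (A : Finset P) (hz : z ∈ A) (hu : u ∈ A)
    (hv : v ∈ A) : ∑ y ∈ A with y ≤ z ∧ ¬ y ≤ p, mult adj (col p) (col y) = 0 := by
  obtain ⟨h1, h2, h3, h4, h5⟩ := H.nb_mem h
  have hs : ({z, u, v} : Finset P) ⊆ A.filter fun y => y ≤ z ∧ ¬ y ≤ p := by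
    intro y hy
    simp only [Finset.mem_insert, Finset.mem_singleton] at hy
    rcases hy with rfl | rfl | rfl
    · simp [hz, (h1.trans h2).not_ge]
    · simp [hu, h2.le, h1.not_ge]
    · simp [hv, h4.le, h3.not_ge]
  rw [← Finset.sum_subset hs, Finset.sum_insert, Finset.sum_insert, Finset.sum_singleton,
    ← H.nb_col h, mult_self, H.mult_of_adj (H.nb_adj h).1, H.mult_of_adj (H.nb_adj h).2]
  · norm_num
  · simpa using h5
  · simp [h2.ne', h4.ne']
  · intro y hy hy'
    simp only [Finset.mem_filter, Finset.mem_insert, Finset.mem_singleton, not_or] at hy hy'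
    have hpy : y < z := lt_of_le_of_ne hy.2.1 hy'.1
    by_cases hyz : p ≤ y
    · have hyz : p < y := lt_of_le_of_ne hyz (fun h => hy.2.2 h.ge)
      rw [mult, if_neg (H.nb_ne h hyz hpy), if_neg]
      intro hA
      rcases H.nb_eq h hA hyz hpy with h | h
      · exact hy'.2.1 h
      · exact hy'.2.2 h
    · exact H.mult_eq_zero hyz hy.2.2

/-- Sums over the elements above `p` within a lower set only depend on the colour of `p`. -/
theorem sum_ge_eq {p z u v : P} (h : nb p z u v) {A : Finset P} (hA : IsLowerSet (A : Set P))
    (hz : z ∈ A) : ∑ y ∈ A with p ≤ y, mult adj (col p) (col y) =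
      ∑ y ∈ A with z ≤ y, mult adj (col z) (col y) := by
  obtain ⟨h1, h2, h3, h4, h5⟩ := H.nb_mem h
  have h0 := H.sum_Ico h A (hA (h1.trans h2).le hz) (hA h2.le hz) (hA h4.le hz)
  rw [← H.nb_col h, ← Finset.sum_filter_add_sum_filter_not _ (fun y => z ≤ y),
    Finset.filter_filter, Finset.filter_filter, h0, add_zero]
  refine Finset.sum_congr (Finset.filter_congr fun y _ => ?_) fun _ _ => rfl
  exact ⟨fun h => h.2, fun h => ⟨(h1.trans h2).le.trans h, h⟩⟩

theorem sum_le_eq {p z u v : P} (h : nb p z u v) {A : Finset P} (hA : IsUpperSet (A : Set P))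
    (hp : p ∈ A) : ∑ y ∈ A with y ≤ z, mult adj (col z) (col y) =
      ∑ y ∈ A with y ≤ p, mult adj (col p) (col y) := by
  obtain ⟨h1, h2, h3, h4, h5⟩ := H.nb_mem h
  have h0 := H.sum_Ioc h A (hA (h1.trans h2).le hp) (hA h1.le hp) (hA h3.le hp)
  rw [← H.nb_col h, ← Finset.sum_filter_add_sum_filter_not _ (fun y => y ≤ p),
    Finset.filter_filter, Finset.filter_filter, h0, add_zero]
  refine Finset.sum_congr (Finset.filter_congr fun y _ => ?_) fun _ _ => rfl
  exact ⟨fun h => h.2, fun h => ⟨h.trans (h1.trans h2).le, h⟩⟩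

variable [Finite P]

/-- Within a lower set, one may pass to the highest element of the same colour. -/
theorem exists_top {A : Finset P} (hA : IsLowerSet (A : Set P)) (x : P) : x ∈ A →
    ∃ t ∈ A, x ≤ t ∧ col t = col x ∧ (∀ y ∈ A, t < y → col y ≠ col t) ∧
      ∑ y ∈ A with x ≤ y, mult adj (col x) (col y) =
        ∑ y ∈ A with t ≤ y, mult adj (col t) (col y) := by
  induction x using (wellFounded_gt (α := P)).induction with
  | _ x ih =>
    intro hx
    by_cases htop : ∀ y ∈ A, x < y → col y ≠ col x
    · exact ⟨x, hx, le_rfl, rfl, htop, rfl⟩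
    push Not at htop
    obtain ⟨y, hy, hxy, hc⟩ := htop
    obtain ⟨z, u, v, hn, hzy⟩ := H.exists_next hc.symm hxy
    have hm := H.nb_mem hn
    have hxz := hm.1.trans hm.2.1
    obtain ⟨t, ht, hzt, h1, h2, h3⟩ := ih z hxz (hA hzy hy)
    exact ⟨t, ht, hxz.le.trans hzt, h1.trans (H.nb_col hn).symm, h2,
      (H.sum_ge_eq hn hA (hA hzy hy)).trans h3⟩

theorem exists_bot {A : Finset P} (hA : IsUpperSet (A : Set P)) (x : P) : x ∈ A →
    ∃ t ∈ A, t ≤ x ∧ col t = col x ∧ (∀ y ∈ A, y < t → col y ≠ col t) ∧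
      ∑ y ∈ A with y ≤ x, mult adj (col x) (col y) =
        ∑ y ∈ A with y ≤ t, mult adj (col t) (col y) := by
  induction x using (wellFounded_lt (α := P)).induction with
  | _ x ih =>
    intro hx
    by_cases htop : ∀ y ∈ A, y < x → col y ≠ col x
    · exact ⟨x, hx, le_rfl, rfl, htop, rfl⟩
    push Not at htop
    obtain ⟨y, hy, hxy, hc⟩ := htop
    obtain ⟨z, u, v, hn, hzy⟩ := H.exists_prev hc hxy
    have hm := H.nb_mem hn
    have hxz := hm.1.trans hm.2.1
    obtain ⟨t, ht, hzt, h1, h2, h3⟩ := ih z hxz (hA hzy hy)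
    exact ⟨t, ht, hzt.trans hxz.le, h1.trans (H.nb_col hn), h2,
      (H.sum_le_eq hn hA (hA hzy hy)).trans h3⟩

end Coloring

/-- The Dynkin label of the colour of `x` in the highest weight. -/
noncomputable def lam [Fintype P] (col : P → ι) (adj : ι → ι → Prop) (x : P) : ℤ :=
  -1 - ∑ y with x ≤ y, mult adj (col x) (col y)

/-- The Dynkin label of the colour of `x` in the weight of the upper set `F`. -/
noncomputable def wt [Fintype P] (col : P → ι) (adj : ι → ι → Prop) (x : P) (F : Finset P) : ℤ :=
  lam col adj x + ∑ y ∈ F, mult adj (col x) (col y)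

namespace Coloring

variable [Fintype P] (H : Coloring col adj nb)
include H

/-- The label is normalised so that the set of elements above `x` has weight `-1`. It is independent
of the choice of `x` in its colour because the sum over the elements above does not change along a
diagonal. -/
theorem lam_congr {x y : P} (h : col x = col y) : lam col adj x = lam col adj y := by
  have hA : IsLowerSet ((Finset.univ : Finset P) : Set P) := by simpa using isLowerSet_univ
  obtain ⟨t, -, -, h1, h2, h3⟩ := H.exists_top hA x (by simp)
  obtain ⟨t', -, -, h1', h2', h3'⟩ := H.exists_top hA y (by simp)
  have htt : t = t' := by
    have hc : col t = col t' := h1.trans (h.trans h1'.symm)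
    rcases H.comp_eq hc with h | h
    · exact (eq_or_lt_of_le h).resolve_right fun h => h2 t' (by simp) h hc.symm
    · exact ((eq_or_lt_of_le h).resolve_right fun h => h2' t (by simp) h hc).symm
  rw [lam, lam, h3, h3', htt]

theorem wt_congr {x y : P} (h : col x = col y) (F : Finset P) :
    wt col adj x F = wt col adj y F := by
  rw [wt, wt, H.lam_congr h, h]

omit [Fintype P] in
theorem card_adj_le_one {t : P} (h : ¬ ∃ z u v, nb t z u v) (B : Finset P) (hB : ∀ y ∈ B, t < y) :
    (B.filter fun y => adj (col t) (col y)).card ≤ 1 := by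
  rw [Finset.card_le_one]
  intro a ha b hb
  rw [Finset.mem_filter] at ha hb
  exact H.top h ha.2 hb.2 (hB a ha.1) (hB b hb.1)

/-- Dominance can be read off at the highest element of the colour: the label there is `1` minus the
number of adjacent elements above it, and that number is at most one. -/
theorem lam_nonneg (x : P) : 0 ≤ lam col adj x := by
  obtain ⟨t, -, -, h1, h2, -⟩ := H.exists_top (A := Finset.univ)
    (by simpa using isLowerSet_univ) x (by simp)
  rw [H.lam_congr h1.symm, lam, sum_split_self _ (Finset.mem_univ t), sum_mult_eq_card]
  · have hn : ¬ ∃ z u v, nb t z u v := by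
      rintro ⟨z, u, v, hn⟩
      have hm := H.nb_mem hn
      exact h2 z (by simp) (hm.1.trans hm.2.1) (H.nb_col hn).symm
    have := H.card_adj_le_one hn (Finset.univ.filter fun y => t < y) (by simp)
    omega
  · intro y hy
    exact h2 y (by simp) (by simpa using hy)

omit H in
theorem lam_eq_one {x : P} (hx : IsMax x) : lam col adj x = 1 := by
  rw [lam, sum_split_self _ (Finset.mem_univ x), Finset.sum_eq_zero]
  · norm_num
  · intro y hy
    exact (hx.not_lt (by simpa using hy)).elim

/-- The weight of an upper set in terms of the highest missing element of a colour. -/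
theorem wt_of_notMem {F : Finset P} (hF : IsUpperSet (F : Set P)) {x : P} (hx : x ∉ F)
    (hx' : ∀ y, x < y → col y = col x → y ∈ F) :
    wt col adj x F = 1 - (({y | x < y ∧ y ∉ F ∧ adj (col x) (col y)} : Finset P).card : ℤ) := by
  have h1 : ∑ y ∈ F, mult adj (col x) (col y) = ∑ y ∈ F with x ≤ y, mult adj (col x) (col y) := by
    rw [Finset.sum_filter]
    refine Finset.sum_congr rfl fun y hy => ?_
    split_ifs with h
    · rfl
    · exact H.mult_eq_zero h fun h' => hx (hF h' hy)
  have h2 : ∑ y with x ≤ y, mult adj (col x) (col y) =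
      ∑ y ∈ F with x ≤ y, mult adj (col x) (col y) +
        ∑ y ∈ Fᶜ with x ≤ y, mult adj (col x) (col y) := by
    rw [← Finset.sum_filter_add_sum_filter_not _ (fun y => y ∈ F), Finset.filter_filter,
      Finset.filter_filter]
    congr 1
    · refine Finset.sum_congr ?_ fun _ _ => rfl
      ext y; simp [and_comm]
    · refine Finset.sum_congr ?_ fun _ _ => rfl
      ext y; simp [and_comm]
  have h3 := sum_split_self (col := col) (adj := adj) (x := x) Fᶜ (by simpa using hx)
  rw [sum_mult_eq_card (Fᶜ.filter fun y => x < y) _ (by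
    intro y hy h
    simp only [Finset.mem_filter, Finset.mem_compl] at hy
    exact hy.1 (hx' y hy.2 h)), Finset.filter_filter] at h3
  have h4 : (Fᶜ.filter fun y => x < y ∧ adj (col x) (col y)) =
      ({y | x < y ∧ y ∉ F ∧ adj (col x) (col y)} : Finset P) := by
    ext y; simp only [Finset.mem_filter, Finset.mem_compl, Finset.mem_univ, true_and]; tauto
  rw [h4] at h3
  rw [wt, lam, h1, h2, h3]
  ring

/-- The weight of an upper set in terms of a minimal element. -/
theorem wt_of_minimal {F : Finset P} (hF : IsUpperSet (F : Set P)) {x : P} (hx : x ∈ F)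
    (hx' : ∀ y ∈ F, ¬ y < x) : wt col adj x F = -1 := by
  have h1 : ∑ y ∈ F, mult adj (col x) (col y) = ∑ y with x ≤ y, mult adj (col x) (col y) := by
    rw [Finset.sum_filter, ← Finset.sum_filter_add_sum_filter_not Finset.univ (fun y => y ∈ F),
      Finset.filter_univ_mem, Finset.sum_eq_zero (s := Finset.univ.filter fun y => y ∉ F), add_zero]
    · refine Finset.sum_congr rfl fun y hy => ?_
      split_ifs with h
      · rfl
      · refine H.mult_eq_zero h fun h' => hx' y hy (lt_of_le_of_ne h' ?_)
        rintro rfl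
        exact h le_rfl
    · intro y hy
      rw [Finset.mem_filter] at hy
      exact if_neg fun h => hy.2 (hF h hx)
  rw [wt, lam, h1]
  ring

theorem wt_of_addable {F : Finset P} (hF : IsUpperSet (F : Set P)) {x : P} (hx : x ∉ F)
    (hx' : ∀ y, x < y → y ∈ F) : wt col adj x F = 1 := by
  rw [H.wt_of_notMem hF hx fun y hy _ => hx' y hy, Finset.card_eq_zero.2]
  · simp
  · rw [Finset.filter_eq_empty_iff]
    rintro y - ⟨h1, h2, -⟩
    exact h2 (hx' y h1)

/-- The last condition keeps `y` below the next element of the colour of `s`, so `y` is one of the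
two neighbours; if there is no next element, at most one adjacent element lies above `s`. -/
theorem card_between_le_two {s : P} (B : Finset P)
    (hB : ∀ y ∈ B, s < y ∧ adj (col s) (col y) ∧ ∀ z, col z = col s → s < z → ¬ z ≤ y) :
    B.card ≤ 2 := by
  by_cases h : ∃ z u v, nb s z u v
  · obtain ⟨z, u, v, hn⟩ := h
    have hm := H.nb_mem hn
    refine (Finset.card_le_card (t := {u, v}) fun y hy => ?_).trans Finset.card_le_two
    obtain ⟨h1, h2, h3⟩ := hB y hy
    have hzy := h3 z (H.nb_col hn).symm (hm.1.trans hm.2.1)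
    have hyz : y < z := by
      rcases H.comp_adj (x := z) (y := y) (H.nb_col hn ▸ h2) with h | h
      · exact (hzy h).elim
      · exact lt_of_le_of_ne h fun h => hzy h.ge
    simpa using H.nb_eq hn h2 h1 hyz
  · have := H.card_adj_le_one h B fun y hy => (hB y hy).1
    rw [Finset.filter_true_of_mem fun y hy => (hB y hy).2.1] at this
    omega

/-- If `p` is minimal in the upper set `U`, then for upper sets `F ⊆ U` the weight of `F` at the
colour of `p` vanishes unless an element of this colour can be added or removed. -/
theorem wt_eq_zero {U F : Finset P} (hU : IsUpperSet (U : Set P)) (hF : IsUpperSet (F : Set P))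
    {p : P} (hp : p ∈ U) (hp' : ∀ y ∈ U, ¬ y < p) (hFU : F ⊆ U)
    (hadd : ∀ a ∈ U, a ∉ F → col a = col p → ¬ ∀ y, a < y → y ∈ F)
    (hrem : ∀ r ∈ F, col r = col p → ¬ ∀ y ∈ F, ¬ y < r) : wt col adj p F = 0 := by
  have hpF : p ∉ F := fun h => hrem p h rfl fun y hy => hp' y (hFU hy)
  obtain ⟨x, hpx, ⟨hx, hxF⟩, hmax⟩ := exists_maximal_ge_of_wellFoundedGT
    (fun w => col w = col p ∧ w ∉ F) p ⟨rfl, hpF⟩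
  have hsame : ∀ y, x < y → col y = col x → y ∈ F := by
    intro y hy hc
    by_contra hyF
    exact hy.not_ge (hmax ⟨hc.trans hx, hyF⟩ hy.le)
  rw [H.wt_congr hx.symm, H.wt_of_notMem hF hxF hsame]
  have hge : 1 ≤ ({y | x < y ∧ y ∉ F ∧ adj (col x) (col y)} : Finset P).card := by
    have := hadd x (hU hpx hp) hxF hx
    push Not at this
    obtain ⟨y, hxy, hyF⟩ := this
    obtain ⟨c, hc, hcy⟩ := exists_covBy_le_of_lt hxy
    rw [Nat.one_le_iff_ne_zero, Finset.card_ne_zero]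
    refine ⟨c, ?_⟩
    simp only [Finset.mem_filter, Finset.mem_univ, true_and]
    exact ⟨hc.lt, fun h => hyF (hF hcy h), H.adj_of_covBy hc⟩
  -- With two missing neighbours, the next element `z` of this colour would lie in `F` with nothing
  -- of `F` below it: an element of `F` covered by `z` would be one of these neighbours. So `z`
  -- would be removable.
  have hle : ({y | x < y ∧ y ∉ F ∧ adj (col x) (col y)} : Finset P).card ≤ 1 := by
    rw [Finset.card_le_one]
    intro a ha b hb
    simp only [Finset.mem_filter, Finset.mem_univ, true_and] at ha hb
    by_contra hne
    by_cases h : ∃ z u v, nb x z u v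
    · obtain ⟨z, u, v, hn⟩ := h
      have hm := H.nb_mem hn
      have hzF : z ∈ F := hsame z (hm.1.trans hm.2.1) (H.nb_col hn).symm
      have hlt : ∀ y, x < y → y ∉ F → adj (col x) (col y) → y = u ∨ y = v := by
        intro y hy hyF hA
        refine H.nb_eq hn hA hy ?_
        rcases H.comp_adj (x := z) (y := y) (H.nb_col hn ▸ hA) with h | h
        · exact (hyF (hF h hzF)).elim
        · exact lt_of_le_of_ne h fun h => hyF (h ▸ hzF)
      have huv : ∀ y, y = u ∨ y = v → y ∉ F := by
        rcases hlt a ha.1 ha.2.1 ha.2.2 with rfl | rfl <;>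
          rcases hlt b hb.1 hb.2.1 hb.2.2 with rfl | rfl
        · exact (hne rfl).elim
        · rintro y (rfl | rfl)
          · exact ha.2.1
          · exact hb.2.1
        · rintro y (rfl | rfl)
          · exact hb.2.1
          · exact ha.2.1
        · exact (hne rfl).elim
      refine hrem z hzF ((H.nb_col hn).symm.trans hx) fun w hw hwz => ?_
      obtain ⟨c, hwc, hc⟩ := exists_le_covBy_of_lt hwz
      have hcF : c ∈ F := hF hwc hw
      have hA : adj (col x) (col c) := H.nb_col hn ▸ H.adj_symm (H.adj_of_covBy hc)
      rcases H.comp_adj hA with h | h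
      · have hxc : x < c := lt_of_le_of_ne h fun h => hxF (h ▸ hcF)
        exact huv c (H.nb_eq hn hA hxc hc.lt) hcF
      · exact hxF (hF h hcF)
    · exact hne (H.top h ha.2.2 hb.2.2 ha.1 hb.1)
  have : ({y | x < y ∧ y ∉ F ∧ adj (col x) (col y)} : Finset P).card = 1 := le_antisymm hle hge
  rw [this]
  norm_num

end Coloring
end
end DComplete

/-! ### Counting adjacent colours inside an interval -/

namespace DComplete

section

open scoped Classical

variable {P ι : Type*} [PartialOrder P] {col : P → ι} {adj : ι → ι → Prop}
  {nb : P → P → P → P → Prop} [Fintype P]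

namespace Coloring

variable (H : Coloring col adj nb)
include H

/-- The sum of multiplicities over the elements of `[s, q]` strictly above `x` is the number of
adjacent elements above the highest element of the colour of `x`. -/
theorem exists_top_Icc {s q x : P} (hsx : s ≤ x) (hxq : x ≤ q) :
    ∃ t, x ≤ t ∧ t ≤ q ∧ col t = col x ∧ (∀ y, t < y → y ≤ q → col y ≠ col t) ∧
      ∑ y with (s ≤ y ∧ y ≤ q) ∧ x < y, mult adj (col x) (col y) =
        (({y | t < y ∧ y ≤ q ∧ adj (col t) (col y)} : Finset P).card : ℤ) := by
  have hA : IsLowerSet (({y | y ≤ q} : Finset P) : Set P) := by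
    intro a b hab ha
    simp only [Finset.coe_filter, Finset.mem_univ, true_and, Set.mem_ofPred_eq] at ha ⊢
    exact hab.trans ha
  obtain ⟨t, ht, hxt, hc, htop, hsum⟩ := H.exists_top hA x (by simpa using hxq)
  have htq : t ≤ q := by simpa using ht
  have htop' : ∀ y, t < y → y ≤ q → col y ≠ col t := fun y h1 h2 => htop y (by simpa using h2) h1
  refine ⟨t, hxt, htq, hc, htop', ?_⟩
  rw [sum_split_self _ (by simpa using hxq), sum_split_self _ ht, add_right_inj,
    Finset.filter_filter, Finset.filter_filter,
    sum_mult_eq_card ({y | y ≤ q ∧ t < y} : Finset P), Finset.filter_filter] at hsum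
  · refine Eq.trans (Finset.sum_congr (Finset.filter_congr fun y _ => ?_) fun _ _ => rfl)
      (hsum.trans ?_)
    · exact ⟨fun h => ⟨h.1.2, h.2⟩, fun h => ⟨⟨hsx.trans h.2.le, h.1⟩, h.2⟩⟩
    · congr 2
      ext y; simp only [Finset.mem_filter, Finset.mem_univ, true_and]; tauto
  · intro y hy
    simp only [Finset.mem_filter, Finset.mem_univ, true_and] at hy
    exact htop' y hy.2 hy.1

theorem exists_bot_Icc {s q x : P} (hsx : s ≤ x) (hxq : x ≤ q) :
    ∃ t, t ≤ x ∧ s ≤ t ∧ col t = col x ∧ (∀ y, y < t → s ≤ y → col y ≠ col t) ∧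
      ∑ y with (s ≤ y ∧ y ≤ q) ∧ y < x, mult adj (col x) (col y) =
        (({y | y < t ∧ s ≤ y ∧ adj (col t) (col y)} : Finset P).card : ℤ) := by
  have hA : IsUpperSet (({y | s ≤ y} : Finset P) : Set P) := by
    intro a b hab ha
    simp only [Finset.coe_filter, Finset.mem_univ, true_and, Set.mem_ofPred_eq] at ha ⊢
    exact ha.trans hab
  obtain ⟨t, ht, hxt, hc, htop, hsum⟩ := H.exists_bot hA x (by simpa using hsx)
  have htq : s ≤ t := by simpa using ht
  have htop' : ∀ y, y < t → s ≤ y → col y ≠ col t := fun y h1 h2 => htop y (by simpa using h2) h1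
  refine ⟨t, hxt, htq, hc, htop', ?_⟩
  rw [sum_split_self' _ (by simpa using hsx), sum_split_self' _ ht, add_right_inj,
    Finset.filter_filter, Finset.filter_filter,
    sum_mult_eq_card ({y | s ≤ y ∧ y < t} : Finset P), Finset.filter_filter] at hsum
  · refine Eq.trans (Finset.sum_congr (Finset.filter_congr fun y _ => ?_) fun _ _ => rfl)
      (hsum.trans ?_)
    · exact ⟨fun h => ⟨h.1.1, h.2⟩, fun h => ⟨⟨h.1, h.2.le.trans hxq⟩, h.2⟩⟩
    · congr 2
      ext y; simp only [Finset.mem_filter, Finset.mem_univ, true_and]; tauto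
  · intro y hy
    simp only [Finset.mem_filter, Finset.mem_univ, true_and] at hy
    exact htop' y hy.2 hy.1

/-- The final contradiction for intervals whose colour sum is orthogonal to its support. -/
theorem false_of_orthogonal {s q : P} (hsq : s < q)
    (hup : ∑ x with s ≤ x ∧ x ≤ q, ∑ y with (s ≤ y ∧ y ≤ q) ∧ x < y, mult adj (col x) (col y) =
      (({y | s ≤ y ∧ y ≤ q} : Finset P).card : ℤ))
    (horth : ∀ x, s ≤ x → x ≤ q → ∑ y with s ≤ y ∧ y ≤ q, mult adj (col x) (col y) = 0)
    {z : P} (hz : col z = col s) (hzq : ¬ z ≤ q) : False := by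
  set I : Finset P := {y | s ≤ y ∧ y ≤ q} with hI
  set F : Finset P := {y | ¬ y ≤ q} with hF
  have hmI : ∀ {y}, y ∈ I ↔ s ≤ y ∧ y ≤ q := by simp [hI]
  have hmF : ∀ {y}, y ∈ F ↔ ¬ y ≤ q := by simp [hF]
  have hFU : IsUpperSet (F : Set P) := by
    intro a b hab ha
    rw [Finset.mem_coe, hmF] at ha ⊢
    exact fun h => ha (hab.trans h)
  -- The pairing of the weight of `F` with the sum of the coroots of `I` is computed in two ways.
  -- Here each term is `1` minus an upward sum, and `hup` makes the total vanish.
  have hwt : ∑ x ∈ I, wt col adj x F = 0 := by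
    have : ∀ x ∈ I, wt col adj x F =
        1 - ∑ y with (s ≤ y ∧ y ≤ q) ∧ x < y, mult adj (col x) (col y) := by
      intro x hx
      rw [hmI] at hx
      obtain ⟨t, h1, h2, h3, h4, h5⟩ := H.exists_top_Icc hx.1 hx.2
      rw [h5, H.wt_congr h3.symm, H.wt_of_notMem hFU (by simpa [hF] using h2)]
      · congr 3
        ext y
        simp [hF]
      · intro y hy hc
        rw [hmF]
        exact fun h => h4 y hy h hc
    rw [Finset.sum_congr rfl this, Finset.sum_sub_distrib, hup]
    simp
  -- An element whose colour occurs in `I` contributes zero by orthogonality, and any other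
  -- contributes nonnegative terms only. With dominance, every summand must vanish.
  have hw : ∀ y ∈ F, 0 ≤ ∑ x ∈ I, mult adj (col x) (col y) := by
    intro y hy
    by_cases hc : ∃ x ∈ I, col x = col y
    · obtain ⟨x, hx, hc⟩ := hc
      rw [← hc]
      refine ge_of_eq (Eq.trans (Finset.sum_congr rfl fun x' _ => H.mult_comm _ _) ?_)
      exact horth x (hmI.1 hx).1 (hmI.1 hx).2
    · push Not at hc
      exact Finset.sum_nonneg fun x hx => mult_nonneg (hc x hx).symm
  have htot : ∑ x ∈ I, lam col adj x + ∑ y ∈ F, ∑ x ∈ I, mult adj (col x) (col y) = 0 := by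
    rw [Finset.sum_comm, ← Finset.sum_add_distrib]
    exact hwt
  have hl0 : 0 ≤ ∑ x ∈ I, lam col adj x := Finset.sum_nonneg fun x _ => H.lam_nonneg x
  have hw0 := Finset.sum_nonneg hw
  have hl : ∀ x ∈ I, lam col adj x = 0 :=
    (Finset.sum_eq_zero_iff_of_nonneg fun x _ => H.lam_nonneg x).1 (by linarith)
  have hw' := (Finset.sum_eq_zero_iff_of_nonneg hw).1 (by linarith)
  -- Take a maximal `y` in `F` whose colour occurs in `I`. It is not maximal in the poset, as its
  -- label is `0` and not `1`; a cover of it has a colour outside `I` adjacent to one in `I`, which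
  -- gives a positive contribution.
  obtain ⟨y, -, ⟨hyF, x, hx, hxy⟩, hmax⟩ := exists_maximal_ge_of_wellFoundedGT
    (fun y => y ∈ F ∧ ∃ x ∈ I, col x = col y) z ⟨hmF.2 hzq, s, hmI.2 ⟨le_rfl, hsq.le⟩, hz.symm⟩
  have hym : ¬ IsMax y := fun h => by
    have h1 := lam_eq_one (col := col) (adj := adj) h
    rw [← H.lam_congr hxy, hl x hx] at h1
    exact zero_ne_one h1
  rw [not_isMax_iff] at hym
  obtain ⟨w, hw1⟩ := hym
  obtain ⟨c, hc, -⟩ := exists_covBy_le_of_lt hw1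
  have hcF : c ∈ F := hFU hc.le hyF
  by_cases hcI : ∃ x ∈ I, col x = col c
  · exact (hmax ⟨hcF, hcI⟩ hc.le).not_gt hc.lt
  · push Not at hcI
    have h1 := (Finset.sum_eq_zero_iff_of_nonneg
      fun x hx => mult_nonneg (hcI x hx).symm).1 (hw' c hcF) x hx
    rw [hxy, H.mult_of_adj (H.adj_of_covBy hc)] at h1
    exact one_ne_zero h1

/-- If `s` is the highest element of its colour below `q`, and `q` is the lowest of its colour
above `s`, then at most one element in `(s, q]` has a colour adjacent to that of `s`. -/
theorem card_adj_le_one_of_Icc (n : ℕ) : ∀ {s q : P}, ({y | s ≤ y ∧ y ≤ q} : Finset P).card = n →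
    s < q → (∀ y, s < y → y ≤ q → col y ≠ col s) → (∀ y, s ≤ y → y < q → col y ≠ col q) →
    ({y | s < y ∧ y ≤ q ∧ adj (col s) (col y)} : Finset P).card ≤ 1 := by
  induction n using Nat.strong_induction_on with
  | _ n ih =>
    intro s q hn hsq hs hq
    by_contra! hcard
    have hlt : ∀ s' q', s ≤ s' → q' ≤ q → (s' ≠ s ∨ q' ≠ q) →
        ({y | s' ≤ y ∧ y ≤ q'} : Finset P).card < n := by
      intro s' q' h1 h2 h3
      rw [← hn]
      refine Finset.card_lt_card ⟨fun y hy => ?_, fun h => ?_⟩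
      · simp only [Finset.mem_filter, Finset.mem_univ, true_and] at hy ⊢
        exact ⟨h1.trans hy.1, hy.2.trans h2⟩
      · have e1 := h (show s ∈ _ by simpa using hsq.le)
        have e2 := h (show q ∈ _ by simpa using hsq.le)
        simp only [Finset.mem_filter, Finset.mem_univ, true_and] at e1 e2
        rcases h3 with h3 | h3
        · exact h3 (le_antisymm e1.1 h1)
        · exact h3 (le_antisymm h2 e2.2)
    set Up : P → ℤ := fun x => ∑ y with (s ≤ y ∧ y ≤ q) ∧ x < y, mult adj (col x) (col y) with hUp
    set Down : P → ℤ := fun x => ∑ y with (s ≤ y ∧ y ≤ q) ∧ y < x, mult adj (col x) (col y)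
      with hDown
    set I : Finset P := {y | s ≤ y ∧ y ≤ q} with hI
    have hmI : ∀ {y}, y ∈ I ↔ s ≤ y ∧ y ≤ q := by simp [hI]
    have hsI : s ∈ I := hmI.2 ⟨le_rfl, hsq.le⟩
    have hqI : q ∈ I := hmI.2 ⟨hsq.le, le_rfl⟩
    -- In a minimal counterexample the upward sums are `2` at `s`, `0` at `q` and, by induction, `1`
    -- in between; the downward sums are bounded below by `0`, `2` and `1` respectively.
    have hUps : Up s = 2 := by
      obtain ⟨t, h1, h2, h3, h4, h5⟩ := H.exists_top_Icc (le_refl s) hsq.le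
      obtain rfl : s = t := (eq_or_lt_of_le h1).resolve_right fun h => hs t h h2 h3
      rw [hUp]
      simp only
      rw [h5]
      have : ({y | s < y ∧ y ≤ q ∧ adj (col s) (col y)} : Finset P).card ≤ 2 := by
        refine H.card_between_le_two (s := s) _ fun y hy => ?_
        simp only [Finset.mem_filter, Finset.mem_univ, true_and] at hy
        exact ⟨hy.1, hy.2.2, fun z hz hsz hzy => hs z hsz (hzy.trans hy.2.1) hz⟩
      omega
    have hUpq : Up q = 0 := by
      rw [hUp]
      refine Finset.sum_eq_zero fun y hy => ?_
      simp only [Finset.mem_filter, Finset.mem_univ, true_and] at hy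
      exact (hy.1.2.not_gt hy.2).elim
    have hUpx : ∀ x ∈ I, x ≠ s → x ≠ q → Up x = 1 := by
      intro x hx hxs hxq
      rw [hmI] at hx
      have hsx : s < x := lt_of_le_of_ne hx.1 (Ne.symm hxs)
      have hxq' : x < q := lt_of_le_of_ne hx.2 hxq
      obtain ⟨t, h1, h2, h3, h4, h5⟩ := H.exists_top_Icc hx.1 hx.2
      have htq : t < q := lt_of_le_of_ne h2 fun h => hq x hx.1 hxq' (h3.symm.trans (h ▸ rfl))
      have hst : s < t := hsx.trans_le h1
      have hle := ih _ (hlt t q hst.le le_rfl (Or.inl hst.ne')) rfl htq h4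
        fun y hy hyq => hq y (hst.le.trans hy) hyq
      have hge : 1 ≤ ({y | t < y ∧ y ≤ q ∧ adj (col t) (col y)} : Finset P).card := by
        obtain ⟨c, hc, hcq⟩ := exists_covBy_le_of_lt htq
        rw [Nat.one_le_iff_ne_zero, Finset.card_ne_zero]
        exact ⟨c, by simpa using ⟨hc.lt, hcq, H.adj_of_covBy hc⟩⟩
      rw [hUp]
      simp only
      rw [h5]
      omega
    have hDs : Down s = 0 := by
      rw [hDown]
      refine Finset.sum_eq_zero fun y hy => ?_
      simp only [Finset.mem_filter, Finset.mem_univ, true_and] at hy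
      exact (hy.1.1.not_gt hy.2).elim
    have hbot : ∀ t, s < t → 1 ≤ ({y | y < t ∧ s ≤ y ∧ adj (col t) (col y)} : Finset P).card := by
      intro t hst
      obtain ⟨c, hsc, hc⟩ := exists_le_covBy_of_lt hst
      rw [Nat.one_le_iff_ne_zero, Finset.card_ne_zero]
      exact ⟨c, by simpa using ⟨hc.lt, hsc, H.adj_symm (H.adj_of_covBy hc)⟩⟩
    have hDx : ∀ x ∈ I, x ≠ s → x ≠ q → 1 ≤ Down x := by
      intro x hx hxs hxq
      rw [hmI] at hx
      have hsx : s < x := lt_of_le_of_ne hx.1 (Ne.symm hxs)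
      obtain ⟨t, h1, h2, h3, h4, h5⟩ := H.exists_bot_Icc hx.1 hx.2
      have hst : s < t := lt_of_le_of_ne h2 fun h => hs x hsx hx.2 (h3.symm.trans (h ▸ rfl))
      have := hbot t hst
      rw [hDown]
      simp only
      rw [h5]
      omega
    have hDq : 2 ≤ Down q := by
      obtain ⟨t, h1, h2, h3, h4, h5⟩ := H.exists_bot_Icc hsq.le (le_refl q)
      obtain rfl : t = q := (eq_or_lt_of_le h1).resolve_right fun h => hq t h2 h h3
      rw [hDown]
      simp only
      rw [h5]
      -- With a single adjacent element below, `q` covers only one element `q₁` of the interval, and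
      -- all of the interval except `q` lies below `q₁`. The count then already fails for `[s, q₁]`.
      by_contra! hD
      obtain ⟨q₁, hsq₁, hq₁⟩ := exists_le_covBy_of_lt hsq
      have hle : ({y | y < t ∧ s ≤ y ∧ adj (col t) (col y)} : Finset P).card ≤ 1 := by omega
      rw [Finset.card_le_one] at hle
      have huniq : ∀ y, y < t → s ≤ y → adj (col t) (col y) → y = q₁ := fun y hy1 hy2 hy3 =>
        hle y (by simpa using ⟨hy1, hy2, hy3⟩) q₁
          (by simpa using ⟨hq₁.lt, hsq₁, H.adj_symm (H.adj_of_covBy hq₁)⟩)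
      have hltq : ∀ y, s ≤ y → y < t → y ≤ q₁ := by
        intro y hy hyt
        obtain ⟨c, hyc, hc⟩ := exists_le_covBy_of_lt hyt
        exact huniq c hc.lt (hy.trans hyc) (H.adj_symm (H.adj_of_covBy hc)) ▸ hyc
      have hne : s ≠ q₁ := by
        rintro rfl
        have : ({y | s < y ∧ y ≤ t ∧ adj (col s) (col y)} : Finset P) ⊆ {t} := by
          intro y hy
          simp only [Finset.mem_filter, Finset.mem_univ, true_and] at hy
          rw [Finset.mem_singleton]
          exact (eq_or_lt_of_le hy.2.1).resolve_right fun h =>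
            hy.1.not_ge (hltq y hy.1.le h)
        have := Finset.card_le_card this
        rw [Finset.card_singleton] at this
        omega
      have hsq₁' : s < q₁ := lt_of_le_of_ne hsq₁ hne
      have h6 := ih _ (hlt s q₁ le_rfl hq₁.le (Or.inr hq₁.ne)) rfl hsq₁'
        (fun y hy hyq => hs y hy (hyq.trans hq₁.le))
        (fun y hy hyq hc => hyq.ne (huniq y (hyq.trans hq₁.lt) hy
          (hc ▸ H.adj_symm (H.adj_of_covBy hq₁))))
      have h7 : ({y | s < y ∧ y ≤ t ∧ adj (col s) (col y)} : Finset P) ⊆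
          ({y | s < y ∧ y ≤ q₁ ∧ adj (col s) (col y)} : Finset P) := by
        intro y hy
        simp only [Finset.mem_filter, Finset.mem_univ, true_and] at hy ⊢
        refine ⟨hy.1, ?_, hy.2.2⟩
        rcases eq_or_lt_of_le hy.2.1 with rfl | h
        · exact (hne (huniq s hsq le_rfl (H.adj_symm hy.2.2))).elim
        · exact hltq y hy.1.le h
      have := Finset.card_le_card h7
      omega
    have hUpsum : ∑ x ∈ I, Up x = (I.card : ℤ) := by
      have h0 : ∀ x ∈ I, Up x - 1 = (if x = s then 1 else 0) - (if x = q then 1 else 0) := by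
        intro x hx
        by_cases h1 : x = s
        · subst h1
          rw [hUps, if_pos rfl, if_neg hsq.ne]
          norm_num
        · by_cases h2 : x = q
          · subst h2
            rw [hUpq, if_neg h1, if_pos rfl]
          · rw [hUpx x hx h1 h2, if_neg h1, if_neg h2]
            norm_num
      have h1 : ∑ x ∈ I, (Up x - 1) = 0 := by
        rw [Finset.sum_congr rfl h0, Finset.sum_sub_distrib, Finset.sum_ite_eq',
          Finset.sum_ite_eq', if_pos hsI, if_pos hqI, sub_self]
      rw [Finset.sum_sub_distrib] at h1
      simp only [Finset.sum_const, nsmul_eq_mul, mul_one] at h1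
      linarith
    -- Symmetry of the Cartan integers: both sides sum over the same comparable pairs.
    have hDownsum : ∑ x ∈ I, Down x = ∑ x ∈ I, Up x := by
      rw [hDown, hUp]
      simp only [← Finset.filter_filter (fun y => s ≤ y ∧ y ≤ q), ← hI, Finset.sum_filter]
      rw [Finset.sum_comm]
      exact Finset.sum_congr rfl fun x _ => Finset.sum_congr rfl fun y _ => by rw [H.mult_comm]
    have hnn : ∀ x ∈ I, 0 ≤ Up x + Down x - 2 := by
      intro x hx
      by_cases h1 : x = s
      · subst h1; rw [hUps, hDs]; norm_num
      · by_cases h2 : x = q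
        · subst h2; rw [hUpq]; linarith
        · rw [hUpx x hx h1 h2]
          have := hDx x hx h1 h2
          linarith
    -- The terms are nonnegative with total zero. So each upward and downward sum add up to `2`,
    -- which cancels the diagonal entry `-2`: the colour sum of the interval is orthogonal to its
    -- own support, as for an imaginary root of affine type.
    have hall := (Finset.sum_eq_zero_iff_of_nonneg hnn).1 (by
      rw [Finset.sum_sub_distrib, Finset.sum_add_distrib, hDownsum, hUpsum]
      simp only [Finset.sum_const, nsmul_eq_mul]
      ring)
    have horth : ∀ x, s ≤ x → x ≤ q → ∑ y with s ≤ y ∧ y ≤ q, mult adj (col x) (col y) = 0 := by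
      intro x hsx hxq
      have hx : x ∈ I := hmI.2 ⟨hsx, hxq⟩
      have h1 := hall x hx
      have h2 : ∑ y ∈ I, mult adj (col x) (col y) = ∑ y ∈ I with x ≤ y, mult adj (col x) (col y) +
          ∑ y ∈ I with y < x, mult adj (col x) (col y) := by
        rw [← Finset.sum_filter_add_sum_filter_not I (fun y => x ≤ y), add_right_inj]
        refine (Finset.sum_subset (fun y hy => ?_) fun y hy hy' => ?_).symm
        · simp only [Finset.mem_filter] at hy ⊢
          exact ⟨hy.1, hy.2.not_ge⟩
        · simp only [Finset.mem_filter, not_and] at hy hy'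
          refine H.mult_eq_zero hy.2 fun h => hy' hy.1 (lt_of_le_of_ne h ?_)
          rintro rfl
          exact hy.2 le_rfl
      rw [sum_split_self I hx, Finset.filter_filter, Finset.filter_filter] at h2
      rw [← hI, h2]
      rw [hUp, hDown] at h1
      simp only at h1
      linarith
    -- Two adjacent elements above `s` force a further element of its colour, which then lies
    -- outside the interval.
    have hz : ∃ z, col z = col s ∧ ¬ z ≤ q := by
      by_cases h : ∃ z u v, nb s z u v
      · obtain ⟨z, u, v, hn⟩ := h
        have hm := H.nb_mem hn
        exact ⟨z, (H.nb_col hn).symm, fun h =>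
          hs z (hm.1.trans hm.2.1) h (H.nb_col hn).symm⟩
      · have := H.card_adj_le_one h (Finset.univ.filter fun y => s < y ∧ y ≤ q)
          (by simp +contextual)
        rw [Finset.filter_filter] at this
        simp only [and_assoc] at this
        omega
    obtain ⟨z, hz, hzq⟩ := hz
    exact H.false_of_orthogonal hsq hUpsum horth hz hzq

end Coloring
end
end DComplete

/-! ### Reflections, the Pieri rule and hook polynomials -/

namespace DComplete

section

open scoped Classical
open MvPolynomial

variable {P ι : Type*} [PartialOrder P] {col : P → ι} {adj : ι → ι → Prop}
  {nb : P → P → P → P → Prop}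

/-- The simple reflection in the colour `k`, acting on polynomials in the simple roots. -/
noncomputable def reflection (adj : ι → ι → Prop) (k : ι) :
    MvPolynomial ι ℚ →ₐ[ℚ] MvPolynomial ι ℚ :=
  aeval fun l => X l + (mult adj k l : MvPolynomial ι ℚ) * X k

theorem reflection_X (k l : ι) :
    reflection adj k (X l) = X l + (mult adj k l : MvPolynomial ι ℚ) * X k := by
  simp [reflection]

theorem reflection_X_self (k : ι) : reflection adj k (X k) = - X k := by
  rw [reflection_X, mult_self]; push_cast; ring

/-- The sum of the simple roots of the elements of `F`. -/
noncomputable def colorSum (col : P → ι) (F : Finset P) : MvPolynomial ι ℚ := ∑ y ∈ F, X (col y)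

omit [PartialOrder P] in
theorem reflection_colorSum (k : ι) (F : Finset P) : reflection adj k (colorSum col F) =
    colorSum col F + ((∑ y ∈ F, mult adj k (col y) : ℤ) : MvPolynomial ι ℚ) * X k := by
  simp only [colorSum, map_sum, reflection_X, Finset.sum_add_distrib, Int.cast_sum,
    Finset.sum_mul]

/-- The elements of `U` that can be added to the upper set `F`. -/
noncomputable def addable (U F : Finset P) : Finset P :=
  U.filter fun q => q ∉ F ∧ ∀ y, q < y → y ∈ F

theorem mem_addable {U F : Finset P} {q : P} :
    q ∈ addable U F ↔ q ∈ U ∧ q ∉ F ∧ ∀ y, q < y → y ∈ F := by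
  simp [addable]

theorem isUpperSet_insert {F : Finset P} (hF : IsUpperSet (F : Set P)) {q : P}
    (hq : ∀ y, q < y → y ∈ F) : IsUpperSet ((insert q F : Finset P) : Set P) := by
  intro a b hab ha
  rw [Finset.mem_coe, Finset.mem_insert] at ha ⊢
  rcases ha with rfl | ha
  · rcases eq_or_lt_of_le hab with rfl | h
    · exact Or.inl rfl
    · exact Or.inr (hq b h)
  · exact Or.inr (hF hab ha)

theorem isUpperSet_erase {F : Finset P} (hF : IsUpperSet (F : Set P)) {r : P}
    (hr : ∀ y ∈ F, ¬ y < r) : IsUpperSet ((F.erase r : Finset P) : Set P) := by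
  intro a b hab ha
  rw [Finset.mem_coe, Finset.mem_erase] at ha ⊢
  refine ⟨?_, hF hab ha.2⟩
  rintro rfl
  exact hr a ha.2 (lt_of_le_of_ne hab ha.1)

/-- The elements of colour `k` that can be removed from the upper set `F`. -/
noncomputable def removable (col : P → ι) (k : ι) (F : Finset P) : Finset P :=
  F.filter fun r => col r = k ∧ ∀ y ∈ F, ¬ y < r

theorem mem_removable {k : ι} {F : Finset P} {r : P} :
    r ∈ removable col k F ↔ r ∈ F ∧ col r = k ∧ ∀ y ∈ F, ¬ y < r := by
  simp [removable]

namespace Coloring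

variable [Fintype P] (H : Coloring col adj nb)
include H

/-- The twisted rule `hY` becomes the untwisted one once the correction terms are added. A colour is
a chain, so it has at most one removable or addable element in `F`, and the three possible weights
`-1`, `1`, `0` are the cases of the proof. -/
theorem pieri_step {U : Finset P} (hU : IsUpperSet (U : Set P)) {p : P} (hp : p ∈ U)
    (hp' : ∀ y ∈ U, ¬ y < p) (Y : Finset P → MvPolynomial ι ℚ)
    (hY : ∀ F : Finset P, IsUpperSet (F : Set P) → F ⊆ U →
      (colorSum col U - colorSum col F - (wt col adj p F : MvPolynomial ι ℚ) * X (col p)) * Y F =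
        ∑ q ∈ addable U F, Y (insert q F))
    (F : Finset P) (hF : IsUpperSet (F : Set P)) (hFU : F ⊆ U) :
    (colorSum col U - colorSum col F) *
        (Y F + X (col p) * ∑ r ∈ removable col (col p) F, Y (F.erase r)) =
      ∑ q ∈ addable U F, (Y (insert q F) +
        X (col p) * ∑ r ∈ removable col (col p) (insert q F), Y ((insert q F).erase r)) := by
  have hcover : ∀ q ∈ addable U F, ∀ r ∈ removable col (col p) (insert q F), r ≠ q →
      r ∈ removable col (col p) F := by
    intro q _ r hr hrq
    rw [mem_removable, Finset.mem_insert] at hr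
    rw [mem_removable]
    exact ⟨hr.1.resolve_left hrq, hr.2.1, fun y hy => hr.2.2 y (Finset.mem_insert_of_mem hy)⟩
  have hadd : ∀ q ∈ addable U F, col q = col p → wt col adj p F = 1 := by
    intro q hq hc
    rw [mem_addable] at hq
    rw [H.wt_congr hc.symm]
    exact H.wt_of_addable hF hq.2.1 hq.2.2
  rw [Finset.sum_add_distrib, ← hY F hF hFU]
  by_cases hr : ∃ r, r ∈ removable col (col p) F
  · obtain ⟨r, hr⟩ := hr
    have hr' := mem_removable.1 hr
    have hwt : wt col adj p F = -1 := by
      rw [H.wt_congr hr'.2.1.symm]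
      exact H.wt_of_minimal hF hr'.1 hr'.2.2
    have huniq : ∀ r' ∈ removable col (col p) F, r' = r := by
      intro r' hr''
      rw [mem_removable] at hr''
      rcases H.comp_eq (hr''.2.1.trans hr'.2.1.symm) with h | h
      · exact (eq_or_lt_of_le h).resolve_right (hr'.2.2 r' hr''.1)
      · exact ((eq_or_lt_of_le h).resolve_right (hr''.2.2 r hr'.1)).symm
    set G := F.erase r with hG
    have hGF : insert r G = F := Finset.insert_erase hr'.1
    have hGup : IsUpperSet (G : Set P) := isUpperSet_erase hF hr'.2.2
    have hrG : r ∉ G := by simp [hG]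
    have hwtG : wt col adj p G = 1 := by
      rw [H.wt_congr hr'.2.1.symm]
      exact H.wt_of_addable hGup hrG fun y hy =>
        Finset.mem_erase.2 ⟨hy.ne', hF hy.le hr'.1⟩
    have hrA : r ∈ addable U G := mem_addable.2 ⟨hFU hr'.1, hrG, fun y hy =>
        Finset.mem_erase.2 ⟨hy.ne', hF hy.le hr'.1⟩⟩
    have hYG := hY G hGup ((Finset.erase_subset _ _).trans hFU)
    rw [← Finset.add_sum_erase _ _ hrA, hGF, hwtG] at hYG
    have hcol : colorSum col F = X (col p) + colorSum col G := by
      rw [colorSum, ← Finset.add_sum_erase _ _ hr'.1, hr'.2.1]; rfl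
    have hremF : removable col (col p) F = {r} :=
      Finset.eq_singleton_iff_unique_mem.2 ⟨hr, huniq⟩
    have hne : ∀ q ∈ addable U F, col q ≠ col p := by
      intro q hq hc
      have := hadd q hq hc
      rw [hwt] at this
      norm_num at this
    -- After adding `q`, the element `r` stays removable unless `q < r`, which is exactly when `q`
    -- is not addable to `G`. The correction terms thus match the twisted rule for `G`, apart from
    -- its term at `r`.
    have hrem : ∀ q ∈ addable U F,
        ∑ r ∈ removable col (col p) (insert q F), Y ((insert q F).erase r) =
          if q ∈ addable U G then Y (insert q G) else 0 := by
      intro q hq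
      have hq' := mem_addable.1 hq
      have hqr : q ≠ r := fun h => hq'.2.1 (h ▸ hr'.1)
      have hsub : ∀ r' ∈ removable col (col p) (insert q F), r' = r := by
        intro r' hr''
        refine huniq r' (hcover q hq r' hr'' ?_)
        rintro rfl
        exact hne r' hq (mem_removable.1 hr'').2.1
      split_ifs with hqG
      · have : removable col (col p) (insert q F) = {r} := by
          refine Finset.eq_singleton_iff_unique_mem.2 ⟨mem_removable.2
            ⟨Finset.mem_insert_of_mem hr'.1, hr'.2.1, fun y hy => ?_⟩, hsub⟩
          rw [Finset.mem_insert] at hy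
          rcases hy with rfl | hy
          · exact fun h => hrG ((mem_addable.1 hqG).2.2 r h)
          · exact hr'.2.2 y hy
        rw [this, Finset.sum_singleton, Finset.erase_insert_of_ne hqr]
      · refine Finset.sum_eq_zero fun r' hr'' => ?_
        obtain rfl := hsub r' hr''
        refine (hqG (mem_addable.2 ⟨hq'.1, fun h => hq'.2.1 (Finset.mem_of_mem_erase h),
          fun y hy => Finset.mem_erase.2 ⟨?_, hq'.2.2 y hy⟩⟩)).elim
        rintro rfl
        exact (mem_removable.1 hr'').2.2 q (Finset.mem_insert_self _ _) hy
    rw [← Finset.mul_sum, Finset.sum_congr rfl hrem, ← Finset.sum_filter]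
    have hset : (addable U F).filter (fun q => q ∈ addable U G) = (addable U G).erase r := by
      ext q
      rw [Finset.mem_filter, Finset.mem_erase]
      constructor
      · rintro ⟨h1, h2⟩
        exact ⟨fun h => (mem_addable.1 h1).2.1 (h ▸ hr'.1), h2⟩
      · rintro ⟨h1, h2⟩
        have h3 := mem_addable.1 h2
        exact ⟨mem_addable.2 ⟨h3.1, fun h => h3.2.1 (Finset.mem_erase.2 ⟨h1, h⟩),
          fun y hy => Finset.mem_of_mem_erase (h3.2.2 y hy)⟩, h2⟩
    rw [hset, hremF, Finset.sum_singleton, hwt, ← hG, hcol]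
    push_cast at hYG ⊢
    linear_combination X (col p) * hYG
  · have hremF : removable col (col p) F = ∅ :=
      Finset.eq_empty_iff_forall_notMem.2 fun r h => hr ⟨r, h⟩
    -- With nothing removable from `F`, a correction arises only by adding an element of this colour
    -- and deleting it again. This contributes `X (col p) * Y F`, the term for weight `1`.
    have hrem : ∀ q ∈ addable U F,
        X (col p) * ∑ r ∈ removable col (col p) (insert q F), Y ((insert q F).erase r) =
          if col q = col p then X (col p) * Y F else 0 := by
      intro q hq
      have hq' := mem_addable.1 hq
      have hsub : ∀ r' ∈ removable col (col p) (insert q F), r' = q := by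
        intro r' hr''
        by_contra hne
        exact hr ⟨r', hcover q hq r' hr'' hne⟩
      split_ifs with hc
      · have : removable col (col p) (insert q F) = {q} := by
          refine Finset.eq_singleton_iff_unique_mem.2 ⟨mem_removable.2
            ⟨Finset.mem_insert_self _ _, hc, fun y hy hyq => ?_⟩, hsub⟩
          rw [Finset.mem_insert] at hy
          rcases hy with rfl | hy
          · exact lt_irrefl _ hyq
          · exact hq'.2.1 (hF hyq.le hy)
        rw [this, Finset.sum_singleton, Finset.erase_insert hq'.2.1]
      · rw [Finset.sum_eq_zero, mul_zero]
        intro r' hr''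
        exact (hc (hsub r' hr'' ▸ (mem_removable.1 hr'').2.1)).elim
    rw [Finset.sum_congr rfl hrem, hremF, Finset.sum_empty, ← Finset.sum_filter]
    by_cases ha : ∃ a ∈ addable U F, col a = col p
    · obtain ⟨a, ha, hac⟩ := ha
      have : (addable U F).filter (fun q => col q = col p) = {a} := by
        refine Finset.eq_singleton_iff_unique_mem.2 ⟨Finset.mem_filter.2 ⟨ha, hac⟩, ?_⟩
        intro q hq
        rw [Finset.mem_filter] at hq
        have h1 := mem_addable.1 hq.1
        have h2 := mem_addable.1 ha
        rcases H.comp_eq (hq.2.trans hac.symm) with h | h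
        · exact (eq_or_lt_of_le h).resolve_right fun h => h2.2.1 (h1.2.2 a h)
        · exact ((eq_or_lt_of_le h).resolve_right fun h => h1.2.1 (h2.2.2 q h)).symm
      rw [this, Finset.sum_singleton, hadd a ha hac]
      push_cast
      ring
    · push Not at ha
      have hwt : wt col adj p F = 0 := by
        refine H.wt_eq_zero hU hF hp hp' hFU ?_ ?_
        · intro a haU haF hc h
          exact ha a (mem_addable.2 ⟨haU, haF, h⟩) hc
        · intro r hrF hc h
          exact hr ⟨r, mem_removable.2 ⟨hrF, hc, h⟩⟩
      rw [Finset.filter_eq_empty_iff.2 fun q hq => ha q hq, Finset.sum_empty, hwt]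
      push_cast
      ring

end Coloring

/-- The polynomials `h q`, `q ∈ U`, are the hook polynomials of the upper set `U`. -/
structure IsHook (col : P → ι) (nb : P → P → P → P → Prop) (U : Finset P)
    (h : P → MvPolynomial ι ℚ) : Prop where
  of_mem : ∀ {q' q u v}, nb q' q u v → q' ∈ U → h q = h u + h v - h q'
  of_notMem : ∀ {q' q u v}, nb q' q u v → q' ∉ U → q ∈ U →
    h q = X (col q) + (if u ∈ U then h u else 0) + (if v ∈ U then h v else 0)
  of_bot : ∀ q ∈ U, (∀ q' u v, nb q' q u v → q' ∉ U) → h q = ∑ y ∈ U with y ≤ q, X (col y)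

namespace Coloring

variable [Fintype P] (H : Coloring col adj nb)
include H

/-- The sum is a difference of two weights at the colour of `p`: that of `U`, which is `1`, and that
of the part of `U` not below `q`. The latter is `1` minus a number of adjacent elements in an
interval ending at `q`, which for `p < q` is exactly one by `card_adj_le_one_of_Icc`. -/
theorem sum_mult_le {U : Finset P} (hU : IsUpperSet (U : Set P)) {p q : P}
    (hpU : p ∉ U) (hp : ∀ c, p < c → c ∈ U)
    (hq : ∀ q' u v, nb q' q u v → q' ∉ insert p U) :
    ∑ y ∈ U with y ≤ q, mult adj (col p) (col y) = if p ≤ q ∧ p ≠ q then 1 else 0 := by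
  set F := U.filter fun y => ¬ y ≤ q with hF
  have hmF : ∀ {y}, y ∈ F ↔ y ∈ U ∧ ¬ y ≤ q := by simp [hF]
  have hFup : IsUpperSet (F : Set P) := by
    intro a b hab ha
    rw [Finset.mem_coe, hmF] at ha ⊢
    exact ⟨hU hab ha.1, fun h => ha.2 (hab.trans h)⟩
  have hw : ∑ y ∈ U with y ≤ q, mult adj (col p) (col y) =
      wt col adj p U - wt col adj p F := by
    rw [wt, wt, ← Finset.sum_filter_add_sum_filter_not U (fun y => y ≤ q)]
    ring
  have hpF : p ∉ F := fun h => hpU (hmF.1 h).1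
  rw [hw, H.wt_of_addable hU hpU hp]
  have hnot : ∀ y ∈ U, ¬ y < p := fun y hy hyp => hpU (hU hyp.le hy)
  obtain ⟨x, hpx, ⟨hx, hxF⟩, hmax⟩ := exists_maximal_ge_of_wellFoundedGT
    (fun w => col w = col p ∧ w ∉ F) p ⟨rfl, hpF⟩
  have hsame : ∀ y, x < y → col y = col x → y ∈ F := by
    intro y hy hc
    by_contra hyF
    exact hy.not_ge (hmax ⟨hc.trans hx, hyF⟩ hy.le)
  rw [H.wt_congr hx.symm, H.wt_of_notMem hFup hxF hsame]
  have hmem : ∀ y, x < y → y ∈ U := fun y hy => hp y (hpx.trans_lt hy)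
  have hset : ({y | x < y ∧ y ∉ F ∧ adj (col x) (col y)} : Finset P) =
      ({y | x < y ∧ y ≤ q ∧ adj (col x) (col y)} : Finset P) := by
    ext y
    simp only [Finset.mem_filter, Finset.mem_univ, true_and, hmF, not_and, not_not]
    exact ⟨fun h => ⟨h.1, h.2.1 (hmem y h.1), h.2.2⟩, fun h => ⟨h.1, fun _ => h.2.1, h.2.2⟩⟩
  rw [hset]
  split_ifs with hpq
  · have hpq' : p < q := lt_of_le_of_ne hpq.1 hpq.2
    have hxq : x ≤ q := by
      by_contra h
      refine hxF (hmF.2 ⟨?_, h⟩)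
      rcases eq_or_lt_of_le hpx with rfl | h'
      · exact (h hpq.1).elim
      · exact hp x h'
    -- Otherwise the predecessor of `q` in its diagonal would lie above `p`, hence in the enlarged
    -- set.
    have hqcol : ∀ y, p ≤ y → y < q → col y ≠ col q := by
      intro y hpy hyq hc
      obtain ⟨z, u, v, hn, hyz⟩ := H.exists_prev hc hyq
      refine hq z u v hn ?_
      rw [Finset.mem_insert]
      rcases eq_or_lt_of_le (hpy.trans hyz) with h | h
      · exact Or.inl h.symm
      · exact Or.inr (hp z h)
    have hxq' : x < q := lt_of_le_of_ne hxq (by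
      rintro rfl
      exact hqcol p le_rfl hpq' hx.symm)
    have hle := H.card_adj_le_one_of_Icc _ rfl hxq'
      (fun y hy hyq hc => (hmF.1 (hsame y hy hc)).2 hyq)
      (fun y hy hyq => hqcol y (hpx.trans hy) hyq)
    have hge : 1 ≤ ({y | x < y ∧ y ≤ q ∧ adj (col x) (col y)} : Finset P).card := by
      obtain ⟨c, hc, hcq⟩ := exists_covBy_le_of_lt hxq'
      rw [Nat.one_le_iff_ne_zero, Finset.card_ne_zero]
      exact ⟨c, by simpa using ⟨hc.lt, hcq, H.adj_of_covBy hc⟩⟩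
    omega
  · rw [Finset.card_eq_zero.2]
    · norm_num
    · rw [Finset.filter_eq_empty_iff]
      rintro y - ⟨h1, h2, -⟩
      exact hpq ⟨(hpx.trans h1.le).trans h2, ((hpx.trans_lt h1).trans_le h2).ne⟩

/-- The reflection is linear on roots, so relations within `U` persist. If `p` is the bottom of an
interval with top `q`, the term `X (col q)` changes sign and supplies `- h p`. If `p` is a neighbour
in an interval whose bottom is still missing, then `X (col q)` becomes `X (col q) + X (col p)` and
supplies the new summand. A plain colour sum gains `X (col p)` exactly when `p` lies below, by
`sum_mult_le`. -/
theorem isHook_insert {U : Finset P} (hU : IsUpperSet (U : Set P)) {p : P} (hpU : p ∉ U)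
    (hp : ∀ c, p < c → c ∈ U) {h : P → MvPolynomial ι ℚ} (hh : IsHook col nb U h) :
    IsHook col nb (insert p U)
      (fun q => if q = p then X (col p) else reflection adj (col p) (h q)) := by
  have hnot : ∀ y ∈ U, ¬ y < p := fun y hy hyp => hpU (hU hyp.le hy)
  have hne : ∀ {y}, y ∈ U → y ≠ p := fun hy h => hpU (h ▸ hy)
  refine ⟨?_, ?_, ?_⟩
  · intro q' q u v hn hq'
    obtain ⟨h1, h2, h3, h4, h5⟩ := H.nb_mem hn
    rw [Finset.mem_insert] at hq'
    rcases hq' with rfl | hq'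
    · have hq : q ∈ U := hp q (h1.trans h2)
      simp only [if_neg (hne (hp u h1)), if_neg (hne (hp v h3)), if_neg (hne hq), if_true]
      rw [hh.of_notMem hn hpU hq, if_pos (hp u h1), if_pos (hp v h3), map_add, map_add,
        ← H.nb_col hn, reflection_X_self]
      ring
    · have hu := hU h1.le hq'
      have hv := hU h3.le hq'
      have hq := hU h2.le hu
      simp only [if_neg (hne hu), if_neg (hne hv), if_neg (hne hq), if_neg (hne hq')]
      rw [hh.of_mem hn hq', map_sub, map_add]
  · intro q' q u v hn hq' hq
    obtain ⟨h1, h2, h3, h4, h5⟩ := H.nb_mem hn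
    rw [Finset.mem_insert, not_or] at hq'
    rw [Finset.mem_insert] at hq
    rcases hq with rfl | hq
    · have hu : u ∉ insert q U := by
        rw [Finset.mem_insert, not_or]
        exact ⟨h2.ne, fun h => hnot u h h2⟩
      have hv : v ∉ insert q U := by
        rw [Finset.mem_insert, not_or]
        exact ⟨h4.ne, fun h => hnot v h h4⟩
      simp only [if_neg hu, if_neg hv, if_true, add_zero]
    · simp only [if_neg (hne hq)]
      rw [hh.of_notMem hn hq'.2 hq, map_add, map_add]
      have hpq : col p ≠ col q := by
        intro hc
        rcases H.comp_eq (hc.trans (H.nb_col hn).symm) with h | h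
        · rcases eq_or_lt_of_le h with h | h
          · exact hq'.1 h.symm
          · exact hq'.2 (hp q' h)
        · have hq'p : q' < p := lt_of_le_of_ne h hq'.1
          have hpq : p < q := by
            rcases H.comp_eq hc with h | h
            · exact lt_of_le_of_ne h (hne hq).symm
            · exact (hnot q hq (lt_of_le_of_ne h (hne hq))).elim
          exact H.nb_ne hn hq'p hpq (hc.trans (H.nb_col hn).symm)
      have key : ∀ w, w ≠ p → reflection adj (col p) (if w ∈ U then h w else 0) =
          if w ∈ insert p U then (if w = p then X (col p) else reflection adj (col p) (h w))
            else 0 := by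
        intro w hw
        have : w ∈ insert p U ↔ w ∈ U := by simp [hw]
        simp only [this, if_neg hw]
        split_ifs <;> simp
      by_cases hA : adj (col p) (col q)
      · have hq'p : q' < p := by
          rcases H.comp_adj (x := p) (y := q') (H.nb_col hn ▸ hA) with h | h
          · rcases eq_or_lt_of_le h with h | h
            · exact (hq'.1 h.symm).elim
            · exact (hq'.2 (hp q' h)).elim
          · exact lt_of_le_of_ne h hq'.1
        have hpq : p < q := by
          rcases H.comp_adj hA with h | h
          · exact lt_of_le_of_ne h (hne hq).symm
          · exact (hnot q hq (lt_of_le_of_ne h (hne hq))).elim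
        rw [reflection_X, H.mult_of_adj hA]
        rcases H.nb_eq hn (H.nb_col hn ▸ H.adj_symm hA) hq'p hpq with rfl | rfl
        · rw [key v h5.symm, if_neg hpU, if_pos (Finset.mem_insert_self _ _), if_pos rfl, map_zero]
          push_cast
          ring
        · rw [key u h5, if_neg hpU, if_pos (Finset.mem_insert_self _ _), if_pos rfl, map_zero]
          push_cast
          ring
      · have hu : u ≠ p := by
          rintro rfl
          exact hA (H.nb_col hn ▸ H.adj_symm (H.nb_adj hn).1)
        have hv : v ≠ p := by
          rintro rfl
          exact hA (H.nb_col hn ▸ H.adj_symm (H.nb_adj hn).2)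
        rw [key u hu, key v hv, reflection_X, mult, if_neg hpq.symm, if_neg hA]
        push_cast
        ring
  · intro q hq hbot
    rw [Finset.mem_insert] at hq
    rcases hq with rfl | hq
    · rw [if_pos rfl]
      have : (insert q U).filter (fun y => y ≤ q) = {q} := by
        refine Finset.eq_singleton_iff_unique_mem.2 ⟨by simp, fun y hy => ?_⟩
        rw [Finset.mem_filter, Finset.mem_insert] at hy
        rcases hy with ⟨rfl | hy, hyq⟩
        · rfl
        · exact (eq_or_lt_of_le hyq).resolve_right (hnot y hy)
      rw [this, Finset.sum_singleton]
    · rw [if_neg (hne hq), hh.of_bot q hq fun q' u v hn h =>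
        hbot q' u v hn (Finset.mem_insert_of_mem h)]
      have h1 := reflection_colorSum (adj := adj) (col := col) (col p) (U.filter fun y => y ≤ q)
      rw [H.sum_mult_le hU hpU hp hbot, colorSum] at h1
      rw [h1, Finset.filter_insert]
      by_cases hpq : p ≤ q
      · rw [if_pos ⟨hpq, (hne hq).symm⟩, if_pos hpq, Finset.sum_insert (by simp [hpU])]
        push_cast
        ring
      · rw [if_neg fun h => hpq h.1, if_neg hpq]
        push_cast
        ring

theorem exists_pieri (U : Finset P) (hU : IsUpperSet (U : Set P)) :
    ∃ (ξ : Finset P → MvPolynomial ι ℚ) (h : P → MvPolynomial ι ℚ), IsHook col nb U h ∧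
      ξ ∅ = 1 ∧ ξ U = ∏ q ∈ U, h q ∧
      ∀ F : Finset P, IsUpperSet (F : Set P) → F ⊆ U → (colorSum col U - colorSum col F) * ξ F =
        ∑ q ∈ addable U F, ξ (insert q F) := by
  revert U
  refine upperSet_induction ⟨fun _ => 1, fun _ => 0, ⟨?_, ?_, ?_⟩, rfl, rfl, ?_⟩ ?_
  · simp
  · simp
  · simp
  · intro F _ hF
    rw [Finset.subset_empty.1 hF]
    simp [addable]
  rintro U p hU hpU hp ⟨ξ, h, hh, h0, h1, h2⟩
  have hnot : ∀ y ∈ insert p U, ¬ y < p := by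
    intro y hy hyp
    rw [Finset.mem_insert] at hy
    rcases hy with rfl | hy
    · exact lt_irrefl _ hyp
    · exact hpU (hU hyp.le hy)
  set s := reflection adj (col p) with hs
  -- Reflecting the rule for `U` subtracts the weight of `F` times `X (col p)` from the new linear
  -- factor, because the weight of `U` itself at this colour is `1`; this is the twisted rule needed
  -- in `pieri_step`.
  set Y : Finset P → MvPolynomial ι ℚ := fun F => if p ∈ F then 0 else s (ξ F) with hYdef
  have hU' := isUpperSet_insert hU hp
  have hcU : colorSum col (insert p U) = X (col p) + colorSum col U := Finset.sum_insert hpU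
  have hY : ∀ F : Finset P, IsUpperSet (F : Set P) → F ⊆ insert p U →
      (colorSum col (insert p U) - colorSum col F -
        (wt col adj p F : MvPolynomial ι ℚ) * X (col p)) * Y F =
        ∑ q ∈ addable (insert p U) F, Y (insert q F) := by
    intro F hF hFU
    by_cases hpF : p ∈ F
    · rw [hYdef]
      simp only [if_pos hpF, mul_zero]
      exact (Finset.sum_eq_zero fun q _ => if_pos (Finset.mem_insert_of_mem hpF)).symm
    · have hFU' : F ⊆ U := fun y hy => (Finset.mem_insert.1 (hFU hy)).resolve_left
        fun h => hpF (h ▸ hy)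
      have h3 := congrArg s (h2 F hF hFU')
      rw [map_mul, map_sub, hs, reflection_colorSum, reflection_colorSum, ← hs, map_sum] at h3
      have h4 : ∑ q ∈ addable (insert p U) F, Y (insert q F) =
          ∑ q ∈ addable U F, s (ξ (insert q F)) := by
        have hsub : addable U F ⊆ addable (insert p U) F := by
          intro q hq
          rw [mem_addable] at hq ⊢
          exact ⟨Finset.mem_insert_of_mem hq.1, hq.2⟩
        rw [← Finset.sum_subset hsub]
        · refine Finset.sum_congr rfl fun q hq => if_neg ?_
          rw [mem_addable] at hq
          rw [Finset.mem_insert, not_or]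
          exact ⟨fun h => hpU (h ▸ hq.1), hpF⟩
        · intro q hq hq'
          rw [mem_addable] at hq hq'
          have : q = p := (Finset.mem_insert.1 hq.1).resolve_right fun h => hq' ⟨h, hq.2⟩
          exact if_pos (this ▸ Finset.mem_insert_self _ _)
      have h5 : wt col adj p U = 1 := H.wt_of_addable hU hpU hp
      rw [h4, ← h3, hYdef]
      simp only [if_neg hpF]
      congr 1
      rw [hcU]
      have h6 : ((∑ y ∈ U, mult adj (col p) (col y) : ℤ) : MvPolynomial ι ℚ) =
          1 - (lam col adj p : MvPolynomial ι ℚ) := by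
        rw [← Int.cast_one, ← h5, wt]; push_cast; ring
      rw [h6, wt]
      push_cast
      ring
  refine ⟨fun F => Y F + X (col p) * ∑ r ∈ removable col (col p) F, Y (F.erase r), _,
    H.isHook_insert hU hpU hp hh, ?_, ?_, ?_⟩
  · simp [removable, hYdef, h0]
  -- At the full set only the term removing `p` survives, which multiplies the reflected product by
  -- the root `X (col p)`.
  · have hpY : Y (insert p U) = 0 := if_pos (Finset.mem_insert_self _ _)
    have hr : removable col (col p) (insert p U) = {p} := by
      refine Finset.eq_singleton_iff_unique_mem.2 ⟨mem_removable.2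
        ⟨Finset.mem_insert_self _ _, rfl, hnot⟩, fun r hr => ?_⟩
      rw [mem_removable] at hr
      rcases H.comp_eq hr.2.1 with h | h
      · exact (eq_or_lt_of_le h).resolve_right (hnot r hr.1)
      · exact ((eq_or_lt_of_le h).resolve_right
          (hr.2.2 p (Finset.mem_insert_self _ _))).symm
    have hYU : Y U = s (ξ U) := if_neg hpU
    simp only [hpY, hr, Finset.sum_singleton, Finset.erase_insert hpU, hYU, h1, zero_add]
    rw [Finset.prod_insert hpU, if_pos rfl, map_prod]
    congr 1
    refine Finset.prod_congr rfl fun q hq => ?_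
    rw [if_neg]
    rintro rfl
    exact hpU hq
  · intro F hF hFU
    exact H.pieri_step hU' (Finset.mem_insert_self _ _) hnot Y hY F hF hFU

end Coloring
end
end DComplete

namespace DComplete

section

/-! ### Sums over linear extensions -/

open scoped Classical

variable {P K : Type*} [PartialOrder P]

/-- `T` lists elements of `S` without repetition, larger elements first. -/
def IsListing (n : ℕ) (S : Finset P) (T : Fin n → P) : Prop :=
  Function.Injective T ∧ (∀ i, T i ∈ S) ∧ ∀ i j, T j < T i → i < j

theorem IsListing.image_eq {n : ℕ} {S : Finset P} {T : Fin n → P} (hT : IsListing n S T)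
    (hS : S.card = n) : Finset.univ.image T = S := by
  refine Finset.eq_of_subset_of_card_le (fun x hx => ?_) ?_
  · obtain ⟨i, -, rfl⟩ := Finset.mem_image.1 hx
    exact hT.2.1 i
  · rw [Finset.card_image_of_injective _ hT.1, hS, Finset.card_univ, Fintype.card_fin]

theorem isListing_cons {n : ℕ} {S : Finset P} (hS : S.card = n + 1) {q : P} {T : Fin n → P} :
    IsListing (n + 1) S (Fin.cons q T) ↔
      (q ∈ S ∧ ∀ x, q < x → x ∉ S) ∧ IsListing n (S.erase q) T := by
  constructor
  · intro h
    have him := h.image_eq hS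
    obtain ⟨h1, h2, h3⟩ := h
    have h1' := Fin.cons_injective_iff.1 h1
    have hq : q ∈ S := by simpa using h2 0
    refine ⟨⟨hq, fun x hx hxS => ?_⟩, h1'.2, fun i => ?_, fun i j hij => ?_⟩
    · rw [← him, Finset.mem_image] at hxS
      obtain ⟨i, -, rfl⟩ := hxS
      exact (Fin.not_lt_zero i) (h3 i 0 (by simpa using hx))
    · refine Finset.mem_erase.2 ⟨fun h => h1'.1 ⟨i, h⟩, by simpa using h2 i.succ⟩
    · exact Fin.succ_lt_succ_iff.1 (h3 i.succ j.succ (by simpa using hij))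
  · rintro ⟨⟨hq, hmax⟩, h1, h2, h3⟩
    refine ⟨Fin.cons_injective_iff.2 ⟨?_, h1⟩, fun i => ?_, fun i j => ?_⟩
    · rintro ⟨i, hi⟩
      exact (Finset.mem_erase.1 (h2 i)).1 hi
    · refine Fin.cases ?_ (fun i => ?_) i
      · simpa using hq
      · simpa using (Finset.mem_erase.1 (h2 i)).2
    · refine Fin.cases ?_ (fun i => ?_) i <;> refine Fin.cases ?_ (fun j => ?_) j
      · simp
      · exact fun _ => Fin.succ_pos j
      · intro h
        simp only [Fin.cons_zero, Fin.cons_succ] at h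
        exact (hmax _ h (Finset.mem_erase.1 (h2 i)).2).elim
      · intro h
        simp only [Fin.cons_succ] at h
        exact Fin.succ_lt_succ_iff.2 (h3 i j h)

variable [Field K]

theorem prod_cons {n : ℕ} {S : Finset P} (hS : S.card = n + 1) (y : P → K) {q : P} {T : Fin n → P}
    (hT : IsListing (n + 1) S (Fin.cons q T)) :
    ∏ i, (∑ j ∈ Finset.Ici i, y ((Fin.cons q T : Fin (n + 1) → P) j))⁻¹ =
      (∑ x ∈ S, y x)⁻¹ * ∏ i, (∑ j ∈ Finset.Ici i, y (T j))⁻¹ := by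
  rw [Fin.prod_univ_succ]
  congr 1
  · rw [← hT.image_eq hS, Finset.sum_image fun a _ b _ h => hT.1 h]
    congr 1
    refine Finset.sum_congr ?_ fun _ _ => rfl
    ext i
    simp
  · refine Finset.prod_congr rfl fun i _ => ?_
    have h1 : ∀ (m : ℕ) (i : Fin m) (f : Fin m → K),
        ∑ j ∈ Finset.Ici i, f j = ∑ j, if i ≤ j then f j else 0 := by
      intro m i f
      rw [← Finset.sum_filter]
      refine Finset.sum_congr ?_ fun _ _ => rfl
      ext j
      simp
    rw [h1, h1, Fin.sum_univ_succ]
    simp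

variable [Fintype P]

/-- The sum of the weights of the listings of `S`, where `n` is the number of elements of `S`. -/
noncomputable def listingSum (y : P → K) (n : ℕ) (S : Finset P) : K :=
  ∑ T : Fin n → P with IsListing n S T, ∏ i, (∑ j ∈ Finset.Ici i, y (T j))⁻¹

/-- The factor at the first position is the total over `S`, whichever element comes first. -/
theorem listingSum_succ {n : ℕ} {S : Finset P} (hS : S.card = n + 1) (y : P → K) :
    listingSum y (n + 1) S = (∑ x ∈ S, y x)⁻¹ *
      ∑ q ∈ S with ∀ x, q < x → x ∉ S, listingSum y n (S.erase q) := by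
  rw [listingSum, Finset.sum_filter,
    ← (Fin.consEquiv fun _ : Fin (n + 1) => P).sum_comp, Fintype.sum_prod_type, Finset.mul_sum,
    Finset.sum_filter]
  rw [← Finset.sum_subset (Finset.subset_univ S)]
  · refine Finset.sum_congr rfl fun q hq => ?_
    split_ifs with hmax
    · rw [listingSum, Finset.sum_filter, Finset.mul_sum]
      refine Finset.sum_congr rfl fun T _ => ?_
      change (if IsListing (n + 1) S (Fin.cons q T) then _ else 0) = _
      by_cases hT : IsListing n (S.erase q) T
      · have hT' := (isListing_cons hS).2 ⟨⟨hq, hmax⟩, hT⟩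
        rw [if_pos hT', if_pos hT]
        exact prod_cons hS y hT'
      · rw [if_neg fun h => hT ((isListing_cons hS).1 h).2, if_neg hT, mul_zero]
    · refine Finset.sum_eq_zero fun T _ => if_neg fun h => hmax ((isListing_cons hS).1 h).1.2
  · intro q _ hq
    refine Finset.sum_eq_zero fun T _ => if_neg fun h => hq ((isListing_cons hS).1 h).1.1

/-- Both sides satisfy the same recursion: a possible first entry of a listing of the complement of
`F` is an element addable to `F`. Multiplying by `ξ` at the full set avoids division by it. -/
theorem listingSum_mul {y : P → K} (hy : ∀ S : Finset P, S.Nonempty → ∑ x ∈ S, y x ≠ 0)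
    {ξ : Finset P → K} (hξ : ∀ F : Finset P, IsUpperSet (F : Set P) →
      (∑ x ∈ Fᶜ, y x) * ξ F = ∑ q ∈ addable Finset.univ F, ξ (insert q F)) (n : ℕ) :
    ∀ F : Finset P, IsUpperSet (F : Set P) → Fᶜ.card = n →
      listingSum y n Fᶜ * ξ Finset.univ = ξ F := by
  induction n with
  | zero =>
    intro F _ hn
    rw [Finset.card_eq_zero, Finset.compl_eq_empty_iff] at hn
    subst hn
    have : (Finset.univ.filter fun T : Fin 0 → P => IsListing 0 Finset.univᶜ T) = Finset.univ := by
      refine Finset.filter_true_of_mem fun T _ => ⟨fun i => i.elim0, fun i => i.elim0,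
        fun i => i.elim0⟩
    rw [listingSum, this]
    simp
  | succ n ih =>
    intro F hF hn
    have hne : ∑ x ∈ Fᶜ, y x ≠ 0 := hy _ (Finset.card_pos.1 (by omega))
    rw [listingSum_succ hn, mul_assoc, inv_mul_eq_iff_eq_mul₀ hne, hξ F hF, Finset.sum_mul]
    have hset : (Fᶜ.filter fun q => ∀ x, q < x → x ∉ Fᶜ) = addable Finset.univ F := by
      ext q
      simp [mem_addable]
    rw [hset]
    refine Finset.sum_congr rfl fun q hq => ?_
    rw [mem_addable] at hq
    have hc : (insert q F)ᶜ = Fᶜ.erase q := by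
      ext x; simp [Finset.mem_erase]
    rw [← hc]
    refine ih _ (isUpperSet_insert hF hq.2.2) ?_
    rw [hc, Finset.card_erase_of_mem (by simpa using hq.2.1), hn, Nat.add_sub_cancel]

theorem sum_weight_eq_listingSum :
    ∑ T : LinExt P, weight T = listingSum (fun p : P =>
      algebraMap (MvPolynomial (Diagonal P) ℚ) (RatField P) (MvPolynomial.X (diag p)))
      (Fintype.card P) Finset.univ := by
  rw [listingSum]
  refine Finset.sum_bij (fun (T : LinExt P) _ => (T.1 : Fin (Fintype.card P) → P)) ?_ ?_ ?_ ?_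
  · intro T _
    rw [Finset.mem_filter]
    exact ⟨Finset.mem_univ _, T.1.injective, fun _ => Finset.mem_univ _, T.2⟩
  · intro T _ T' _ h
    exact Subtype.ext (DFunLike.coe_injective h)
  · intro T hT
    rw [Finset.mem_filter] at hT
    have hb : Function.Bijective T :=
      (Fintype.bijective_iff_injective_and_card T).2 ⟨hT.2.1, by simp⟩
    exact ⟨⟨Equiv.ofBijective T hb, hT.2.2.2⟩, Finset.mem_univ _, rfl⟩
  · intro T _
    rw [weight, Finset.prod_inv_distrib]

end

/-! ### Hook vectors of a `d`-complete poset and the final formula -/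

section

open scoped Classical
open MvPolynomial

theorem sum_X_ne_zero {P ι : Type*} (col : P → ι) (S : Finset P) (hS : S.Nonempty) :
    ∑ x ∈ S, (X (col x) : MvPolynomial ι ℚ) ≠ 0 := by
  intro h
  have := congrArg (eval fun _ => (1 : ℚ)) h
  simp only [map_sum, eval_X, map_zero, Finset.sum_const, nsmul_eq_mul, mul_one,
    Nat.cast_eq_zero, Finset.card_eq_zero] at this
  exact hS.ne_empty this

variable {P : Type*} [PartialOrder P] [Fintype P]

theorem IsDComplete.isHookVectorFamily (hP : IsDComplete P) :
    IsHookVectorFamily (hookVector (P := P)) := by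
  constructor
  · intro p hp D
    rw [hookVector, dif_neg]
    rintro ⟨t, ht⟩
    exact hp (isNeck_iff.2 ⟨_, _, _, isDIntervalWithSides_iff.1 ht⟩)
  · intro p' w z p h
    have hex : ∃ t : P × P × P, IsDIntervalWithSides t.1 t.2.1 t.2.2 p := ⟨(p', w, z), h⟩
    have hc := hex.choose_spec
    rw [isDIntervalWithSides_iff] at h hc
    obtain ⟨h1, h2⟩ := hP.dInt_unique_of_top h hc
    rw [hookVector, dif_pos hex]
    rcases h2 with ⟨h2, h3⟩ | ⟨h2, h3⟩
    · rw [← h1, ← h2, ← h3]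
    · rw [← h1, ← h2, ← h3, add_comm (hookVector z)]

theorem sum_zsmul_X_eq_sum (q : P) :
    ∑ D : Diagonal P, (Nat.card {y : P // y ≤ q ∧ diag y = D} : ℤ) •
      (X D : MvPolynomial (Diagonal P) ℚ) = ∑ y with y ≤ q, X (diag y) := by
  rw [← Finset.sum_fiberwise ({y | y ≤ q} : Finset P) diag]
  refine Finset.sum_congr rfl fun D _ => ?_
  rw [Finset.sum_congr rfl (g := fun _ => X D) fun y hy => by rw [(Finset.mem_filter.1 hy).2],
    Finset.sum_const, Nat.card_eq_fintype_card, Fintype.card_subtype, Finset.filter_filter,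
    natCast_zsmul]

theorem IsDComplete.hookPoly_eq (hP : IsDComplete P) {h : P → MvPolynomial (Diagonal P) ℚ}
    (hh : IsHook diag Nb Finset.univ h) (q : P) : hookPoly q = h q := by
  have hV := hP.isHookVectorFamily
  -- `IsHook` recurses through the neighbours, which for a longer interval are the inner top and
  -- bottom, while hook vectors recurse through the sides. Adding the relations of the nested
  -- intervals telescopes one into the other.
  have hsides : ∀ {p z a b : P}, DInt p z a b → h z = h a + h b - h p := by
    intro p z a b hd
    induction hd with
    | diamond h1 h2 h3 h4 h5 h6 =>
      exact hh.of_mem (.diamond h1 h2 h3 h4 h5 h6) (Finset.mem_univ _)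
    | extend h1 h2 h3 h4 ih =>
      rw [hh.of_mem (.extend h1 h2 h3 h4) (Finset.mem_univ _), ih]
      ring
  induction q using (wellFounded_lt (α := P)).induction with
  | _ q ih =>
    by_cases hn : IsNeck q
    · obtain ⟨p', a, b, hd⟩ := isNeck_iff.1 hn
      have hs := hd.sides
      have h1 := hV.of_dInterval p' a b q (isDIntervalWithSides_iff.2 hd)
      rw [hsides hd, ← ih a hs.2.1, ← ih b hs.2.2.2.1, ← ih p' hd.lt, hookPoly, h1]
      simp only [hookPoly, Pi.add_apply, Pi.sub_apply, add_smul, sub_smul, Finset.sum_add_distrib,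
        Finset.sum_sub_distrib]
    · rw [hh.of_bot q (Finset.mem_univ _), ← sum_zsmul_X_eq_sum, hookPoly]
      · exact Finset.sum_congr rfl fun D _ => by rw [hV.of_not_neck q hn D]
      · intro q' u v hnb
        obtain ⟨a, b, hd⟩ := hnb.exists_dInt
        exact (hn (isNeck_iff.2 ⟨_, _, _, hd⟩)).elim

theorem IsDComplete.sum_weight (hP : IsDComplete P) : ∑ T : LinExt P, weight T =
    1 / ∏ p : P, algebraMap (MvPolynomial (Diagonal P) ℚ) (RatField P) (hookPoly p) := by
  set φ := algebraMap (MvPolynomial (Diagonal P) ℚ) (RatField P) with hφ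
  have hinj : Function.Injective φ := IsFractionRing.injective _ _
  obtain ⟨ξ, h, hh, h0, h1, h2⟩ := hP.coloring.exists_pieri Finset.univ
    (by simpa using isUpperSet_univ)
  have hprod : φ (ξ Finset.univ) = ∏ p : P, φ (hookPoly p) := by
    rw [h1, map_prod]
    exact Finset.prod_congr rfl fun q _ => by rw [hP.hookPoly_eq hh]
  have key := listingSum_mul (y := fun p : P => φ (X (diag p))) (ξ := fun F => φ (ξ F))
    (fun S hS => by
      rw [← map_sum]
      exact (map_ne_zero_iff φ hinj).2 (sum_X_ne_zero diag S hS))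
    (fun F hF => by
      rw [← map_sum, ← map_sum, ← map_mul, ← h2 F hF (Finset.subset_univ F)]
      congr 2
      rw [colorSum, colorSum, ← Finset.sum_compl_add_sum F, add_sub_cancel_right])
    (Fintype.card P) ∅ (by simpa using isUpperSet_empty) (by simp [Finset.card_univ])
  rw [Finset.compl_empty, h0, map_one, hprod] at key
  rw [sum_weight_eq_listingSum]
  exact eq_one_div_of_mul_eq_one_left key

end

end DComplete

theorem mainTheorem1 {P : Type*} [PartialOrder P] [Fintype P] (hP : DComplete.IsDComplete P) :
    DComplete.IsHookVectorFamily (DComplete.hookVector (P := P)) ∧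
    ∑ T : DComplete.LinExt P, DComplete.weight T =
      1 / ∏ p : P, algebraMap (MvPolynomial (DComplete.Diagonal P) ℚ) (DComplete.RatField P)
        (DComplete.hookPoly p) :=
  ⟨hP.isHookVectorFamily, hP.sum_weight⟩
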